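/- **Theorem 6.2.** Let $K$ be a field and let $\Gamma=(V,E)$ be a layered graph: a directed graph (with sets $V$ of vertices and $E$ of edges, each edge $e$ having a tail $\mathbf t(e)$ and a head $\mathbf h(e)$) together with a decomposition $V=\bigsqcup_{i=0}^n V_i$ into levels such that every edge goes from (its tail in) some $V_i$ with $1\le i\le n$ to (its head in) $V_{i-1}$. Suppose that $\Gamma$ is *complete*, i.e. for all $1\le i\le n$, $v\in V_i$, $w\in V_{i-1}$ there is an edge from $v$ to $w$, and that $\Gamma$ has a unique minimal vertex $*$ (a vertex is minimal if it is not the tail of any edge), with $V_0=\{*\}$. For a directed path $\pi=(e_1,\dots,e_m)$, $m\ge 1$ (so $\mathbf h(e_i)=\mathbf t(e_{i+1})$), put $P_\pi(t)=(t-e_1)\cdots(t-e_m)\in T(E)[t]$, where $T(E)$ is the free associative $K$-algebra on $E$ and $t$ is a central variable. The *splitting algebra* $A(\Gamma)$ is the quotient of $T(E)$ by the two-sided ideal generated by all coefficients of $P_{\pi_1}(t)-P_{\pi_2}(t)$, where $\pi_1,\pi_2$ are paths with the same origin and the same end. It is graded by giving every edge degree $1$. For $e\in E$ with $\mathbf t(e)\in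 V_i$ put $|e|=i$, and let $F_l\subseteq A(\Gamma)$ be the span of all products $e_1\cdots e_r$ ($r\ge 0$) with $|e_1|+\cdots+|e_r|\le l$. Let $\operatorname{gr}A(\Gamma)=\bigoplus_{l\ge 0}F_l/F_{l-1}$ (with $F_{-1}=0$) be the associated graded algebra of this filtration, graded by the degree induced from $A(\Gamma)$: its component of degree $d$ is the direct sum over $l$ of the images of $A(\Gamma)_d\cap F_l$ in $F_l/F_{l-1}$ (so the class of an edge has degree $1$). Then $\operatorname{gr}A(\Gamma)$ and $A(\Gamma)$ are Koszul algebras. Here a graded $K$-algebra $A=\bigoplus_{d\ge 0}A_d$ with $A_0=K$ is called Koszul if the trivial graded left module $K=A/\bigoplus_{d\ge1}A_d$ has a graded free resolution $\cdots\to P_2\to P_1\to P_0\to K\to 0$ in which each $P_i$ is generated in degree $i$. -/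

import Mathlib

open scoped DirectSum

universe uK uV uE uA

/-- A layered graph of height `n` with vertex set `V` and edge set `E` (parallel edges are allowed).
The vertex set is the disjoint union of the levels `V_i = {v | level v = i}`, `0 ≤ i ≤ n`, and every
edge goes from a vertex of some level `i` (its tail) to a vertex of level `i - 1` (its head). -/
structure LayeredGraph (V : Type uV) (E : Type uE) where
  height : ℕ
  tail : E → V
  head : E → V
  level : V → ℕ
  level_le : ∀ v, level v ≤ height
  level_tail : ∀ e, level (tail e) = level (head e) + 1

namespace LayeredGraph

variable {V : Type uV} {E : Type uE} (Γ : LayeredGraph V E)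

/-- A vertex is minimal if it is not the tail of any edge. -/
def IsMinimal (v : V) : Prop := ∀ e, Γ.tail e ≠ v

/-- A layered graph is complete if every vertex of level `i` is joined by an edge to every vertex of
level `i - 1`. -/
def IsComplete : Prop :=
  ∀ v w : V, Γ.level v = Γ.level w + 1 → ∃ e, Γ.tail e = v ∧ Γ.head e = w

/-- `Γ.IsPath v w π` says that the nonempty list of edges `π = [e₁, …, e_m]` is a directed path
from `v` to `w`: the tail of `e₁` is `v`, the head of each edge is the tail of the next one, and
the head of `e_m` is `w`. -/
inductive IsPath : V → V → List E → Prop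
  | single (e : E) : IsPath (Γ.tail e) (Γ.head e) [e]
  | cons (e : E) {w : V} {π : List E} (h : IsPath (Γ.head e) w π) : IsPath (Γ.tail e) w (e :: π)

variable (K : Type uK) [Field K]

/-- The polynomial `P_π(t) = (t - e₁) ⋯ (t - e_m)` in the free algebra on the edges, where `t` is a
central variable. -/
noncomputable def pathPoly (π : List E) : Polynomial (FreeAlgebra K E) :=
  (π.map fun e => Polynomial.X - Polynomial.C (FreeAlgebra.ι K e)).prod

/-- The defining relations of the splitting algebra: for two paths with the same origin and the same
end, all corresponding coefficients of their polynomials are identified. -/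
inductive SplittingRel : FreeAlgebra K E → FreeAlgebra K E → Prop
  | coeff {v w : V} {π₁ π₂ : List E} (h₁ : Γ.IsPath v w π₁) (h₂ : Γ.IsPath v w π₂) (k : ℕ) :
      SplittingRel ((pathPoly K π₁).coeff k) ((pathPoly K π₂).coeff k)

/-- The splitting algebra `A(Γ)` over the field `K`: the quotient of the free algebra on the edges by
the two-sided ideal generated by the relations `P_{π₁}(t) = P_{π₂}(t)`. -/
def SplittingAlgebra : Type (max uK uE) := RingQuot (Γ.SplittingRel K)

noncomputable instance : Ring (Γ.SplittingAlgebra K) :=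
  inferInstanceAs (Ring (RingQuot (Γ.SplittingRel K)))

noncomputable instance : Algebra K (Γ.SplittingAlgebra K) :=
  inferInstanceAs (Algebra K (RingQuot (Γ.SplittingRel K)))

/-- The generator of `A(Γ)` given by an edge. -/
noncomputable def edge (e : E) : Γ.SplittingAlgebra K :=
  RingQuot.mkAlgHom K (Γ.SplittingRel K) (FreeAlgebra.ι K e)

/-- The component of degree `n` of `A(Γ)`, every edge having degree one: the span of all products of
exactly `n` edges. -/
noncomputable def degreePart (n : ℕ) : Submodule K (Γ.SplittingAlgebra K) :=
  Submodule.span K {x | ∃ π : List E, π.length = n ∧ x = (π.map (Γ.edge K)).prod}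

/-- The span of all products `e₁ ⋯ e_r` of edges (`r ≥ 0`) with `|e₁| + ⋯ + |e_r| ≤ l`, where `|e|`
is the level of the tail of `e`. -/
noncomputable def levelPart (l : ℕ) : Submodule K (Γ.SplittingAlgebra K) :=
  Submodule.span K {x | ∃ π : List E, (π.map fun e => Γ.level (Γ.tail e)).sum ≤ l ∧
    x = (π.map (Γ.edge K)).prod}

end LayeredGraph

/-- An increasing multiplicative filtration, indexed by the natural numbers, of a `K`-algebra. -/
structure AlgFiltration (K : Type uK) (A : Type uA) [Field K] [Ring A] [Algebra K A] where
  part : ℕ → Submodule K A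
  mono : Monotone part
  one_mem : (1 : A) ∈ part 0
  mul_mem : ∀ {i j : ℕ} {a b : A}, a ∈ part i → b ∈ part j → a * b ∈ part (i + j)

namespace AlgFiltration

variable {K : Type uK} {A : Type uA} [Field K] [Ring A] [Algebra K A] (F : AlgFiltration K A)

/-- The part of the filtration of index strictly below `i` (zero for `i = 0`, and `F_{i-1}`
otherwise). -/
def below (i : ℕ) : Submodule K A := ⨆ j, ⨆ _ : j < i, F.part j

theorem below_zero : F.below 0 = ⊥ := by simp [below]

theorem below_succ (i : ℕ) : F.below (i + 1) = F.part i := by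
  refine le_antisymm (iSup₂_le fun j hj => F.mono (Nat.lt_succ_iff.1 hj)) ?_
  exact le_iSup₂_of_le i (Nat.lt_succ_self i) le_rfl

theorem mul_mem_below_left {i j : ℕ} {a b : A} (ha : a ∈ F.below i) (hb : b ∈ F.part j) :
    a * b ∈ F.below (i + j) := by
  cases i with
  | zero => rw [below_zero, Submodule.mem_bot] at ha; simp [ha]
  | succ i =>
    rw [below_succ] at ha
    rw [Nat.add_right_comm, below_succ]
    exact F.mul_mem ha hb

theorem mul_mem_below_right {i j : ℕ} {a b : A} (ha : a ∈ F.part i) (hb : b ∈ F.below j) :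
    a * b ∈ F.below (i + j) := by
  cases j with
  | zero => rw [below_zero, Submodule.mem_bot] at hb; simp [hb]
  | succ j =>
    rw [below_succ] at hb
    rw [Nat.add_succ, Nat.succ_eq_add_one, below_succ]
    exact F.mul_mem ha hb

/-- The graded piece `F_i / F_{i-1}`. -/
abbrev Piece (i : ℕ) : Type uA := F.part i ⧸ (F.below i).submoduleOf (F.part i)

/-- The class in `F_i / F_{i-1}` of an element of `F_i`. -/
def cls (i : ℕ) : F.part i →ₗ[K] F.Piece i := Submodule.mkQ _

theorem cls_eq_zero {i : ℕ} {a : F.part i} : F.cls i a = 0 ↔ (a : A) ∈ F.below i := by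
  rw [cls, Submodule.mkQ_apply, Submodule.Quotient.mk_eq_zero]
  rfl

theorem cls_surjective (i : ℕ) : Function.Surjective (F.cls i) := Submodule.mkQ_surjective _

/-- Multiplication `F_i × F_j → F_{i+j}`. -/
def mulPart (i j : ℕ) : F.part i →ₗ[K] F.part j →ₗ[K] F.part (i + j) :=
  LinearMap.mk₂ K (fun a b => ⟨(a : A) * b, F.mul_mem a.2 b.2⟩)
    (fun a b c => Subtype.ext (by simp [add_mul]))
    (fun r a b => Subtype.ext (by simp))
    (fun a b c => Subtype.ext (by simp [mul_add]))
    (fun r a b => Subtype.ext (by simp))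

/-- Multiplication `F_i / F_{i-1} × F_j / F_{j-1} → F_{i+j} / F_{i+j-1}`, induced by the
multiplication of `A`. -/
def mulPiece (i j : ℕ) : F.Piece i →ₗ[K] F.Piece j →ₗ[K] F.Piece (i + j) :=
  Submodule.liftQ _
    { toFun := fun a => Submodule.liftQ _ ((F.cls (i + j)).comp (F.mulPart i j a))
        (fun b hb => by
          rw [LinearMap.mem_ker, LinearMap.comp_apply, cls_eq_zero]
          exact F.mul_mem_below_right a.2 hb)
      map_add' := fun a b => by ext c; simp
      map_smul' := fun r a => by ext c; simp }
    (fun a ha => by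
      rw [LinearMap.mem_ker]
      ext b
      simp only [LinearMap.coe_mk, AddHom.coe_mk, LinearMap.comp_apply, Submodule.mkQ_apply,
        Submodule.liftQ_apply, LinearMap.zero_apply]
      rw [cls_eq_zero]
      exact F.mul_mem_below_left ha b.2)

theorem mulPiece_cls {i j : ℕ} (a : F.part i) (b : F.part j) :
    F.mulPiece i j (F.cls i a) (F.cls j b) = F.cls (i + j) ⟨(a : A) * b, F.mul_mem a.2 b.2⟩ := rfl

theorem mk_cls_congr {i j : ℕ} (h : i = j) {a : F.part i} {b : F.part j} (hab : (a : A) = b) :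
    (GradedMonoid.mk i (F.cls i a) : GradedMonoid F.Piece) = GradedMonoid.mk j (F.cls j b) := by
  subst h
  rw [Subtype.ext hab]

instance gMul : GradedMonoid.GMul F.Piece where
  mul {i j} a b := F.mulPiece i j a b

instance gOne : GradedMonoid.GOne F.Piece where
  one := F.cls 0 ⟨1, F.one_mem⟩

instance gSemiring : DirectSum.GSemiring F.Piece where
  mul_zero a := map_zero (F.mulPiece _ _ a)
  zero_mul b := LinearMap.map_zero₂ (F.mulPiece _ _) b
  mul_add a b c := map_add (F.mulPiece _ _ a) b c
  add_mul a b c := LinearMap.map_add₂ (F.mulPiece _ _) a b c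
  one_mul := by
    rintro ⟨i, a⟩
    obtain ⟨a, rfl⟩ := F.cls_surjective i a
    exact F.mk_cls_congr (zero_add i) (one_mul _)
  mul_one := by
    rintro ⟨i, a⟩
    obtain ⟨a, rfl⟩ := F.cls_surjective i a
    exact F.mk_cls_congr (add_zero i) (mul_one _)
  mul_assoc := by
    rintro ⟨i, a⟩ ⟨j, b⟩ ⟨k, c⟩
    obtain ⟨a, rfl⟩ := F.cls_surjective i a
    obtain ⟨b, rfl⟩ := F.cls_surjective j b
    obtain ⟨c, rfl⟩ := F.cls_surjective k c
    exact F.mk_cls_congr (add_assoc i j k) (mul_assoc _ _ _)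
  natCast n := n • F.cls 0 ⟨1, F.one_mem⟩
  natCast_zero := zero_smul _ _
  natCast_succ n := succ_nsmul _ n

instance gRing : DirectSum.GRing F.Piece where
  intCast n := n • F.cls 0 ⟨1, F.one_mem⟩
  intCast_ofNat n := natCast_zsmul _ n
  intCast_negSucc_ofNat n := negSucc_zsmul _ n

instance gAlgebra : DirectSum.GAlgebra K F.Piece where
  toFun := ((LinearMap.toSpanSingleton K (F.Piece 0) (F.cls 0 ⟨1, F.one_mem⟩))).toAddMonoidHom
  map_one := one_smul K (F.cls 0 ⟨1, F.one_mem⟩)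
  map_mul r s := by
    change GradedMonoid.mk 0 ((r * s) • F.cls 0 ⟨1, F.one_mem⟩) =
      GradedMonoid.mk (0 + 0) (F.mulPiece 0 0 (r • F.cls 0 ⟨1, F.one_mem⟩)
        (s • F.cls 0 ⟨1, F.one_mem⟩))
    rw [← map_smul, ← map_smul, ← map_smul, mulPiece_cls]
    exact F.mk_cls_congr rfl (by simp [smul_smul, mul_comm])
  commutes := by
    rintro r ⟨i, a⟩
    obtain ⟨a, rfl⟩ := F.cls_surjective i a
    change GradedMonoid.mk (0 + i) (F.mulPiece 0 i (r • F.cls 0 ⟨1, F.one_mem⟩) (F.cls i a)) =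
      GradedMonoid.mk (i + 0) (F.mulPiece i 0 (F.cls i a) (r • F.cls 0 ⟨1, F.one_mem⟩))
    rw [← map_smul, mulPiece_cls, mulPiece_cls]
    exact F.mk_cls_congr (by simp) (by simp)
  smul_def := by
    rintro r ⟨i, a⟩
    obtain ⟨a, rfl⟩ := F.cls_surjective i a
    change GradedMonoid.mk i (r • F.cls i a) =
      GradedMonoid.mk (0 + i) (F.mulPiece 0 i (r • F.cls 0 ⟨1, F.one_mem⟩) (F.cls i a))
    rw [← map_smul, ← map_smul, mulPiece_cls]
    exact F.mk_cls_congr (by simp) (by simp)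

/-- The associated graded algebra `gr A = ⨁ i, F_i / F_{i-1}`. -/
abbrev Gr : Type uA := ⨁ i, F.Piece i

instance grRing : Ring F.Gr := DirectSum.ring F.Piece

instance grAlgebra : Algebra K F.Gr := inferInstanceAs (Algebra K (⨁ i, F.Piece i))

/-- The element of `gr A` given by the class in `F_i / F_{i-1}` of an element of `F_i`. -/
def symbol (i : ℕ) : F.part i →ₗ[K] F.Gr :=
  (DirectSum.lof K ℕ F.Piece i).comp (F.cls i)

/-- The subspace of `gr A` induced by a subspace `W` of `A`: the sum over all `i` of the images of
`W ∩ F_i` in `F_i / F_{i-1}`. -/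
def inducedPart (W : Submodule K A) : Submodule K F.Gr :=
  ⨆ i, (W.submoduleOf (F.part i)).map (F.symbol i)

end AlgFiltration

namespace LayeredGraph

variable {V : Type uV} {E : Type uE} (Γ : LayeredGraph V E) (K : Type uK) [Field K]

/-- The filtration of `A(Γ)` by the levels of the edges. -/
noncomputable def filtration : AlgFiltration K (Γ.SplittingAlgebra K) where
  part := Γ.levelPart K
  mono i j hij := Submodule.span_mono fun _ ⟨π, h, hx⟩ => ⟨π, h.trans hij, hx⟩
  one_mem := Submodule.subset_span ⟨[], by simp, by simp⟩
  mul_mem {i j a b} ha hb := by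
    have h := Submodule.mul_mem_mul ha hb
    rw [levelPart, levelPart, Submodule.span_mul_span] at h
    refine Submodule.span_mono ?_ h
    rintro _ ⟨_, ⟨π, hπ, rfl⟩, _, ⟨ρ, hρ, rfl⟩, rfl⟩
    exact ⟨π ++ ρ, by simpa using add_le_add hπ hρ, by simp⟩

/-- The associated graded algebra `gr A(Γ)` of the filtration of `A(Γ)` by levels. -/
abbrev GrSplittingAlgebra : Type (max uK uE) := (Γ.filtration K).Gr

/-- The component of degree `n` of `gr A(Γ)` for the grading induced by the degree of `A(Γ)`
(so the class of every edge has degree one). -/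
noncomputable def grDegreePart (n : ℕ) : Submodule K (Γ.GrSplittingAlgebra K) :=
  (Γ.filtration K).inducedPart (Γ.degreePart K n)

end LayeredGraph

/-- The left ideal generated by the components of positive degree of a graded algebra. For a graded
algebra this is `A_+ = ⨁ n ≥ 1, A_n`. -/
def irrelevantIdeal {K : Type uK} {A : Type uA} [Field K] [Ring A] [Algebra K A]
    (𝒜 : ℕ → Submodule K A) : Ideal A :=
  Ideal.span {a | ∃ n, a ∈ 𝒜 (n + 1)}

/-- The `K`-algebra `A` with the family of subspaces `𝒜 0, 𝒜 1, …` is a Koszul algebra: these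
subspaces make `A` a connected graded algebra (`𝒜 0 = K`), and the trivial graded left `A`-module
`K = A / A_+` has a linear free resolution
`⋯ → P_2 → P_1 → P_0 → K → 0`. Here `P_i` is the free left `A`-module on a set `B i` of generators of
degree `i`; that the differential is homogeneous of degree zero means that its matrix entries lie
in `𝒜 1`. (The map from `P_0` to `A / A_+`, which is concentrated in degree `0`, is automatically
homogeneous.) -/
structure IsKoszul (K : Type uK) (A : Type uA) [Field K] [Ring A] [Algebra K A]
    (𝒜 : ℕ → Submodule K A) : Prop where
  nontrivial : Nontrivial A
  gradedMonoid : SetLike.GradedMonoid 𝒜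
  isInternal : DirectSum.IsInternal 𝒜
  connected : 𝒜 0 = Submodule.span K {1}
  linearResolution : ∃ (B : ℕ → Type uA) (d : ∀ i, (B (i + 1) →₀ A) →ₗ[A] (B i →₀ A))
    (ε : (B 0 →₀ A) →ₗ[A] A ⧸ irrelevantIdeal 𝒜),
    Function.Surjective ε ∧ Function.Exact (d 0) ε ∧
    (∀ i, Function.Exact (d (i + 1)) (d i)) ∧
    ∀ i (b : B (i + 1)) (c : B i), d i (Finsupp.single b 1) c ∈ 𝒜 1

/-! Choose a base vertex on every level. Let d_v be the class of an edge from v to the base vertex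
one level below. Put x_v = d_v if v is a base vertex, and x_v = d_v - d_b otherwise, where b is the
base vertex on the level of v. Comparing paths of length two gives, for u not a base vertex, b the
base vertex on its level and v one level above u: x_v x_u = x_u x_u + x_u x_b if v is a base vertex,
and x_v x_u = 0 otherwise. The right-hand side has weight one less than the left, so it disappears
in the associated graded algebra. Both algebras thus obey the rules `LevelAlphabet.Rel ε`, with ε =
1 for A(Γ) and ε = 0 for gr A(Γ).

These rules behave as a quadratic Gröbner basis: the words without forbidden adjacent pairs form a
basis. They span by rewriting (`Rel.mul_mem_normalSpan`). They are independent because the letters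
act on the space of normal words (`rel_letterEnd`), and `IsPath.prod_eq` turns this into an action
of A(Γ). Degree components and filtration steps are spanned by parts of this one basis, so the basis
passes to gr A(Γ).

Koszulity follows from an explicit resolution of Anick type (`Rel.isKoszul`). Its m-th module is
free on the words c of length m all of whose adjacent pairs are forbidden. With [c] the generator,
the differential has leading term w[gc] ↦ (wg)[c], so exactness follows by comparing leading terms
(`exact_of_triangular`). Its matrix entries are linear in the letters. -/

/-- An alphabet whose letters have levels, together with a distinguished letter `base g` on the
level of each letter `g`, depending only on that level. -/
structure LevelAlphabet (G : Type*) where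
  level : G → ℕ
  base : G → G
  level_base : ∀ g, level (base g) = level g
  base_eq : ∀ {g h}, level g = level h → base g = base h

/-! ### Normal words and rewriting. -/

namespace LevelAlphabet

variable {G : Type*} (L : LevelAlphabet G)

/-- The pairs of letters that may not be adjacent in a normal word. -/
def Forb (g h : G) : Prop := L.base h ≠ h ∧ L.level g = L.level h + 1

/-- The normal words: those without forbidden pairs of adjacent letters. -/
def IsNormal (w : List G) : Prop := w.IsChain fun g h => ¬ L.Forb g h

/-- The weight of a word is the sum of the levels of its letters. -/
def weight (w : List G) : ℕ := (w.map L.level).sum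

variable {L}

@[simp] theorem weight_nil : L.weight [] = 0 := rfl

@[simp] theorem weight_cons (g : G) (w : List G) : L.weight (g :: w) = L.level g + L.weight w := by
  simp [weight]

@[simp] theorem weight_append (v w : List G) : L.weight (v ++ w) = L.weight v + L.weight w := by
  simp [weight]

theorem base_base (g : G) : L.base (L.base g) = L.base g := L.base_eq (L.level_base g)

theorem not_forb_base (g h : G) : ¬ L.Forb g (L.base h) := fun hf => hf.1 (base_base h)

theorem not_forb_of_level_eq {g h : G} (hl : L.level g = L.level h) : ¬ L.Forb g h := fun hf => by
  have := hf.2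
  omega

/-- The left letter of a pair matters only through its level, so it may be exchanged for the base
letter of that level. This asymmetry keeps rewritten words normal and chains of forbidden pairs
closed under replacing their first letter. -/
theorem forb_congr {g g' h : G} (hl : L.level g = L.level g') : L.Forb g h ↔ L.Forb g' h := by
  simp [Forb, hl]

theorem isNormal_nil : L.IsNormal [] := List.isChain_nil

theorem isNormal_singleton (g : G) : L.IsNormal [g] := List.isChain_singleton g

theorem isNormal_cons_cons {g h : G} {w : List G} :
    L.IsNormal (g :: h :: w) ↔ ¬ L.Forb g h ∧ L.IsNormal (h :: w) := List.isChain_cons_cons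

theorem IsNormal.tail {g : G} {w : List G} (h : L.IsNormal (g :: w)) : L.IsNormal w :=
  List.IsChain.tail h

theorem IsNormal.cons_of_level_eq {g g' : G} {w : List G} (h : L.IsNormal (g :: w))
    (hl : L.level g = L.level g') : L.IsNormal (g' :: w) := by
  cases w with
  | nil => exact isNormal_singleton _
  | cons a w =>
    rw [isNormal_cons_cons] at h ⊢
    rwa [← forb_congr hl]

theorem IsNormal.double {g : G} {w : List G} (h : L.IsNormal (g :: w)) :
    L.IsNormal (g :: g :: w) :=
  isNormal_cons_cons.2 ⟨not_forb_of_level_eq rfl, h⟩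

theorem IsNormal.cons_base {g : G} {w : List G} (h : L.IsNormal (g :: w)) :
    L.IsNormal (g :: L.base g :: w) :=
  isNormal_cons_cons.2 ⟨not_forb_base _ _, h.cons_of_level_eq (L.level_base g).symm⟩

theorem IsNormal.dropLast {w : List G} {g : G} (h : L.IsNormal (w ++ [g])) : L.IsNormal w :=
  (List.isChain_append.1 h).1

theorem exists_forb_of_not_isNormal {w : List G} {g : G} (hw : L.IsNormal w)
    (h : ¬ L.IsNormal (w ++ [g])) : ∃ v a, w = v ++ [a] ∧ L.Forb a g := by
  rcases List.eq_nil_or_concat w with rfl | ⟨v, a, rfl⟩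
  · exact absurd (isNormal_singleton g) h
  · refine ⟨v, a, by simp, ?_⟩
    by_contra hf
    refine h (List.isChain_append.2 ⟨hw, List.isChain_singleton g, ?_⟩)
    simpa using hf

variable {K : Type*} {R : Type*} [Field K] [Ring R] [Algebra K R]

variable (L) in
/-- The rewriting rules for the forbidden pairs: `g h = 0` if `g` is not distinguished, and
`g h = ε (h h + h h')` with `h' = base h` otherwise. -/
structure Rel (ε : K) (γ : G → R) : Prop where
  mul_eq_zero : ∀ {g h}, L.Forb g h → L.base g ≠ g → γ g * γ h = 0
  mul_eq : ∀ {g h}, L.Forb g h → L.base g = g →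
    γ g * γ h = ε • (γ h * γ h + γ h * γ (L.base h))

variable (L K) in
/-- The span of the normal words of length `n` and weight at most `l`. -/
def normalSpan (γ : G → R) (n l : ℕ) : Submodule K R :=
  Submodule.span K {x | ∃ w, L.IsNormal w ∧ w.length = n ∧ L.weight w ≤ l ∧ x = (w.map γ).prod}

variable {ε : K} {γ : G → R}

theorem prod_mem_normalSpan {w : List G} (hw : L.IsNormal w) {n l : ℕ} (hn : w.length = n)
    (hl : L.weight w ≤ l) : (w.map γ).prod ∈ L.normalSpan K γ n l :=
  Submodule.subset_span ⟨w, hw, hn, hl, rfl⟩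

theorem normalSpan_mono {n l l' : ℕ} (h : l ≤ l') :
    L.normalSpan K γ n l ≤ L.normalSpan K γ n l' :=
  Submodule.span_mono fun _ ⟨w, hw, hn, hl, hx⟩ => ⟨w, hw, hn, hl.trans h, hx⟩

/-- One rewriting step suffices. If hw is normal and gh is forbidden, then hhw and hh'w with h' =
base h are already normal: letters of equal level never form a forbidden pair, and h' may precede w
because h may. Length is kept and the weight drops by one. -/
theorem Rel.mul_mem_normalSpan (hγ : L.Rel ε γ) (g : G) {n l : ℕ} {a : R}
    (ha : a ∈ L.normalSpan K γ n l) :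
    γ g * a ∈ L.normalSpan K γ (n + 1) (L.level g + l) := by
  induction ha using Submodule.span_induction with
  | zero => simp
  | add x y _ _ hx hy => rw [mul_add]; exact add_mem hx hy
  | smul r x _ hx => rw [mul_smul_comm]; exact Submodule.smul_mem _ _ hx
  | mem x hx =>
    obtain ⟨w, hw, hn, hl, rfl⟩ := hx
    cases w with
    | nil =>
      have := prod_mem_normalSpan (K := K) (γ := γ) (isNormal_singleton (L := L) g)
        (n := n + 1) (l := L.level g + l) (by simpa using hn.symm) (by simp)
      simpa using this
    | cons h w =>
      simp only [List.length_cons, weight_cons] at hn hl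
      by_cases hf : L.Forb g h
      · rw [List.map_cons, List.prod_cons, ← mul_assoc]
        by_cases hg : L.base g = g
        · rw [hγ.mul_eq hf hg, smul_mul_assoc, add_mul, mul_assoc, mul_assoc]
          have hlev := hf.2
          refine Submodule.smul_mem _ _ (add_mem ?_ ?_)
          · simpa using prod_mem_normalSpan (K := K) (γ := γ) hw.double (n := n + 1)
              (l := L.level g + l) (by simpa using hn) (by simp; omega)
          · simpa using prod_mem_normalSpan (K := K) (γ := γ) hw.cons_base (n := n + 1)
              (l := L.level g + l) (by simpa using hn) (by simp [L.level_base]; omega)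
        · rw [hγ.mul_eq_zero hf hg, zero_mul]
          exact zero_mem _
      · simpa using prod_mem_normalSpan (K := K) (γ := γ) (isNormal_cons_cons.2 ⟨hf, hw⟩)
          (n := n + 1) (l := L.level g + l) (by simpa using hn) (by simpa using hl)

theorem Rel.prod_mem (hγ : L.Rel ε γ) (w : List G) :
    (w.map γ).prod ∈ L.normalSpan K γ w.length (L.weight w) := by
  induction w with
  | nil => exact prod_mem_normalSpan isNormal_nil rfl le_rfl
  | cons g w ih => simpa using hγ.mul_mem_normalSpan g ih

end LevelAlphabet

/-! ### Exactness from leading terms. -/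

open Module in
/-- A criterion for exactness by comparing leading terms with respect to weighted bases. -/
theorem exact_of_triangular {K P Q N β κ : Type*} [Field K] [AddCommGroup P] [AddCommGroup Q]
    [AddCommGroup N] [Module K P] [Module K Q] [Module K N] (f : P →ₗ[K] Q) (g : Q →ₗ[K] N)
    (hfg : ∀ p, g (f p) = 0) (b : Basis β K Q) (c : Basis κ K N) (wt : β → ℕ) (wt' : κ → ℕ)
    (I : Set β) (φ : β → κ) (hφ : Set.InjOn φ I) (hwt : ∀ x ∈ I, wt' (φ x) = wt x)
    (hI : ∀ x ∈ I, g (b x) - c (φ x) ∈ Submodule.span K (c '' {y | wt' y < wt x}))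
    (hII : ∀ x ∉ I, ∃ p, f p - b x ∈ Submodule.span K (b '' {y | wt y < wt x})) :
    Function.Exact f g := by
  classical
  -- By induction on the weight, every basis vector is congruent modulo the range of f to a
  -- combination of vectors indexed by I.
  have hspan : ∀ n x, wt x < n →
      b x ∈ LinearMap.range f ⊔ Submodule.span K (b '' I) := by
    intro n
    induction n with
    | zero => intro x hx; omega
    | succ n ih =>
      intro x hx
      by_cases hxI : x ∈ I
      · exact Submodule.mem_sup_right (Submodule.subset_span ⟨x, hxI, rfl⟩)
      · obtain ⟨p, hp⟩ := hII x hxI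
        have h1 : Submodule.span K (b '' {y | wt y < wt x}) ≤
            LinearMap.range f ⊔ Submodule.span K (b '' I) := by
          rw [Submodule.span_le]
          rintro _ ⟨y, hy, rfl⟩
          exact ih y (lt_of_lt_of_le hy (Nat.lt_succ_iff.1 hx))
        have h2 := sub_mem (Submodule.mem_sup_left (T := Submodule.span K (b '' I))
          (LinearMap.mem_range_self f p)) (h1 hp)
        simpa using h2
  have htop : LinearMap.range f ⊔ Submodule.span K (b '' I) = ⊤ := by
    rw [eq_top_iff, ← b.span_eq, Submodule.span_le]
    rintro _ ⟨x, rfl⟩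
    exact hspan _ x (Nat.lt_succ_self _)
  intro q
  constructor
  · intro hq
    have hq' : q ∈ LinearMap.range f ⊔ Submodule.span K (b '' I) := htop ▸ Submodule.mem_top
    obtain ⟨_, ⟨p, rfl⟩, t, ht, rfl⟩ := Submodule.mem_sup.1 hq'
    rw [map_add, hfg, zero_add] at hq
    suffices t = 0 from ⟨p, by simp [this]⟩
    by_contra hne
    rw [Basis.mem_span_image] at ht
    have hsupp : (b.repr t).support.Nonempty := by
      rw [Finsupp.support_nonempty_iff]
      simpa using hne
    -- For x of maximal weight in the support of t, the coefficient of c (φ x) in g t is that of x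
    -- in t. The other leading terms sit at different indices by injectivity of φ, and all lower
    -- terms have weight below that of φ x.
    obtain ⟨x, hx, hmax⟩ := Finset.exists_max_image _ wt hsupp
    have hzero : c.repr (g t) (φ x) = 0 := by rw [hq]; simp
    have hcoef : ∀ y ∈ (b.repr t).support,
        c.repr (g (b y)) (φ x) = if y = x then 1 else 0 := by
      intro y hy
      have h1 := hI y (ht hy)
      rw [Basis.mem_span_image] at h1
      have h2 : c.repr (g (b y) - c (φ y)) (φ x) = 0 := by
        by_contra hc
        have h3 : wt' (φ x) < wt y := h1 (Finsupp.mem_support_iff.2 hc)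
        rw [hwt x (ht hx)] at h3
        exact absurd (hmax y hy) (by omega)
      rw [map_sub, Finsupp.sub_apply, sub_eq_zero, Basis.repr_self] at h2
      rw [h2, Finsupp.single_apply]
      by_cases hyx : y = x
      · simp [hyx]
      · rw [if_neg hyx, if_neg fun hh => hyx (hφ (ht hy) (ht hx) hh)]
    have hsum : c.repr (g t) (φ x) = b.repr t x := by
      conv_lhs => rw [← b.linearCombination_repr t, Finsupp.linearCombination_apply, Finsupp.sum]
      rw [map_sum, map_sum, Finsupp.finsetSum_apply, Finset.sum_eq_single x]
      · simp [hcoef x hx]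
      · intro y hy hyx
        simp [hcoef y hy, hyx]
      · intro hx'
        exact absurd hx hx'
    exact (Finsupp.mem_support_iff.1 hx) (hsum ▸ hzero)
  · rintro ⟨p, rfl⟩
    exact hfg p

/-! ### The resolution on chains of forbidden pairs. -/

namespace LevelAlphabet

variable {G : Type*} (L : LevelAlphabet G)

/-- The words of length `m` in which all pairs of adjacent letters are forbidden. -/
abbrev ForbChain (m : ℕ) : Type _ := {c : List G // c.IsChain L.Forb ∧ c.length = m}

variable {K R : Type*} [Field K] [Ring R] [Algebra K R]

variable (R) in
open Classical in
/-- The generator of the `m`-th module of the resolution given by a word (zero if the word is not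
a chain of forbidden pairs of length `m`). -/
noncomputable def gen (m : ℕ) (c : List G) : L.ForbChain m →₀ R :=
  if h : c.IsChain L.Forb ∧ c.length = m then Finsupp.single ⟨c, h⟩ 1 else 0

open Classical in
/-- The boundary of a generator of the resolution. -/
noncomputable def boundary (ε : K) (γ : G → R) (m : ℕ) : List G → (L.ForbChain m →₀ R)
  | [] => 0
  | [g] => γ g • L.gen R m []
  | g :: h :: c =>
    if L.base g = g then
      (γ g - ε • γ h) • L.gen R m (h :: c) - (ε • γ h) • L.gen R m (L.base h :: c)
    else γ g • L.gen R m (h :: c)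

/-- The differential of the resolution. -/
noncomputable def differential (ε : K) (γ : G → R) (m : ℕ) :
    (L.ForbChain (m + 1) →₀ R) →ₗ[R] (L.ForbChain m →₀ R) :=
  Finsupp.linearCombination R fun c => L.boundary ε γ m c.1

variable {L} {ε : K} {γ : G → R}

theorem gen_eq {m : ℕ} (c : L.ForbChain m) : L.gen R m c.1 = Finsupp.single c 1 := by
  rw [gen, dif_pos c.2]

theorem differential_gen {m : ℕ} {c : List G} (hc : c.IsChain L.Forb) (hm : c.length = m + 1) :
    L.differential ε γ m (L.gen R (m + 1) c) = L.boundary ε γ m c := by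
  rw [gen, dif_pos ⟨hc, hm⟩, differential, Finsupp.linearCombination_single, one_smul]

theorem isChain_forb_base {h : G} {c : List G} (hc : (h :: c).IsChain L.Forb) :
    (L.base h :: c).IsChain L.Forb := by
  cases c with
  | nil => exact List.isChain_singleton _
  | cons a c =>
    rw [List.isChain_cons_cons] at hc ⊢
    exact ⟨(forb_congr (L.level_base h)).2 hc.1, hc.2⟩

/-- In a chain g, h, … the letter h is not a base letter. If g is not one either, the composite
contains the factor γ g * γ h = 0. If g is a base letter, a third letter a contributes only terms
containing γ h * γ a = 0, and what remains is the rewriting rule for gh. -/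
theorem Rel.differential_boundary (hγ : L.Rel ε γ) {m : ℕ} {c : List G}
    (hc : c.IsChain L.Forb) (hm : c.length = m + 2) :
    L.differential ε γ m (L.boundary ε γ (m + 1) c) = 0 := by
  match c, hc, hm with
  | g :: h :: c, hc, hm =>
    rw [List.isChain_cons_cons] at hc
    obtain ⟨hf, hc⟩ := hc
    have hh : L.base h ≠ h := hf.1
    have hm' : (h :: c).length = m + 1 := by simpa using hm
    have hm'' : (L.base h :: c).length = m + 1 := by simpa using hm
    by_cases hg : L.base g = g
    · rw [boundary, if_pos hg, map_sub, map_smul, map_smul, differential_gen hc hm',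
        differential_gen (isChain_forb_base hc) hm'']
      have h1 := hγ.mul_eq hf hg
      cases c with
      | nil =>
        simp only [boundary, ← mul_smul, ← sub_smul]
        rw [sub_mul, h1, smul_mul_assoc, smul_mul_assoc, smul_add, add_sub_cancel_left, sub_self,
          zero_smul]
      | cons a c =>
        have ha := (List.isChain_cons_cons.1 hc).1
        have h0 := hγ.mul_eq_zero ha hh
        rw [boundary, boundary, if_neg hh, if_pos (base_base h)]
        simp only [smul_sub, ← mul_smul]
        have e1 : ε • γ h * (ε • γ a) = 0 := by
          rw [smul_mul_assoc, mul_smul_comm, h0, smul_zero, smul_zero]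
        rw [e1, zero_smul, sub_zero, ← sub_smul, sub_mul, mul_sub, e1, h1, smul_mul_assoc,
          smul_mul_assoc, smul_add, sub_zero, add_sub_cancel_left, sub_self, zero_smul]
    · rw [boundary, if_neg hg, map_smul, differential_gen hc hm']
      have h1 := hγ.mul_eq_zero hf hg
      cases c with
      | nil => rw [boundary, ← mul_smul, h1, zero_smul]
      | cons a c => rw [boundary, if_neg hh, ← mul_smul, h1, zero_smul]

theorem Rel.differential_comp (hγ : L.Rel ε γ) (m : ℕ) (x : L.ForbChain (m + 2) →₀ R) :
    L.differential ε γ m (L.differential ε γ (m + 1) x) = 0 := by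
  induction x using Finsupp.induction_linear with
  | zero => simp
  | add x y hx hy => rw [map_add, map_add, hx, hy, add_zero]
  | single c r =>
    have : Finsupp.single c r = r • L.gen R (m + 2) c.1 := by simp [gen_eq]
    rw [this, map_smul, map_smul, differential_gen c.2.1 c.2.2,
      hγ.differential_boundary c.2.1 c.2.2, smul_zero]

section Basis

open Module

variable (b : Basis {w : List G // L.IsNormal w} K R)

/-- The basis of a module of the resolution over the ground field. -/
noncomputable def chainBasis (m : ℕ) :
    Basis (Σ _ : L.ForbChain m, {w : List G // L.IsNormal w}) K (L.ForbChain m →₀ R) :=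
  Finsupp.basis fun _ => b

theorem chainBasis_apply (m : ℕ) (x) : chainBasis b m x = Finsupp.single x.1 (b x.2) := by
  simp [chainBasis]

/-- The total weight of a basis element of the resolution. -/
def chainWeight (m : ℕ) (x : Σ _ : L.ForbChain m, {w : List G // L.IsNormal w}) : ℕ :=
  L.weight x.1.1 + L.weight x.2.1

variable {b} (hb : ∀ w, b w = (w.1.map γ).prod)
include hb

theorem smul_gen_mem {m n l N : ℕ} {a : R} (ha : a ∈ L.normalSpan K γ n l) {c : List G}
    (hN : L.weight c + l < N) :
    a • L.gen R m c ∈ Submodule.span K (chainBasis b m '' {y | chainWeight m y < N}) := by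
  by_cases hc : c.IsChain L.Forb ∧ c.length = m
  · induction ha using Submodule.span_induction with
    | zero => simp
    | add x y _ _ hx hy => rw [add_smul]; exact add_mem hx hy
    | smul r x _ hx => rw [smul_assoc]; exact Submodule.smul_mem _ _ hx
    | mem x hx =>
      obtain ⟨w, hw, hn, hl, rfl⟩ := hx
      refine Submodule.subset_span ⟨⟨⟨c, hc⟩, ⟨w, hw⟩⟩, ?_, ?_⟩
      · simp only [chainWeight, Set.mem_ofPred_eq]
        omega
      · rw [chainBasis_apply, hb, gen, dif_pos hc, Finsupp.smul_single, smul_eq_mul, mul_one]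
  · rw [gen, dif_neg hc, smul_zero]
    exact zero_mem _

/-- This identifies the leading term of the differential. The corrections carry wh in front of [hc]
or [h'c] with h' = base h, so an h or h' has replaced g and the weight is one smaller. The word wh
need not be normal, but rewriting it does not raise the weight. -/
theorem Rel.smul_boundary_mem (hγ : L.Rel ε γ) {m : ℕ} {g : G} {c w : List G}
    (hc : (g :: c).IsChain L.Forb) :
    (w.map γ).prod • L.boundary ε γ m (g :: c) - ((w ++ [g]).map γ).prod • L.gen R m c ∈
      Submodule.span K (chainBasis b m '' {y | chainWeight m y < L.weight (g :: c) + L.weight w}) := by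
  have hprod : ∀ h, (w.map γ).prod * γ h = ((w ++ [h]).map γ).prod := fun h => by simp
  cases c with
  | nil => rw [boundary, ← mul_smul, hprod, sub_self]; exact zero_mem _
  | cons h c =>
    have hf := (List.isChain_cons_cons.1 hc).1.2
    by_cases hg : L.base g = g
    · rw [boundary, if_pos hg, smul_sub, ← mul_smul, ← mul_smul, mul_sub, sub_smul, hprod,
        mul_smul_comm, hprod, sub_right_comm,
        sub_sub_cancel_left, ← neg_add', smul_assoc, smul_assoc]
      have hmem := hγ.prod_mem (w ++ [h])
      refine neg_mem (add_mem (Submodule.smul_mem _ _ (smul_gen_mem hb hmem ?_))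
        (Submodule.smul_mem _ _ (smul_gen_mem hb hmem ?_)))
      · simp; omega
      · simp [L.level_base]; omega
    · rw [boundary, if_neg hg, ← mul_smul, hprod, sub_self]
      exact zero_mem _

/-- The leading term moves the first letter of the chain to the end of the word. If wg is normal,
the image of w[gc] has leading term (wg)[c], from which w, g and c can be recovered. If wg is not
normal, w[gc] is itself the leading term of a boundary. -/
theorem Rel.differential_exact (hγ : L.Rel ε γ) (m : ℕ) :
    Function.Exact (L.differential ε γ (m + 1)) (L.differential ε γ m) := by
  have key : ∀ {m : ℕ} {g : G} {c w : List G} (hw : L.IsNormal w)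
      (hc : (g :: c).IsChain L.Forb ∧ (g :: c).length = m + 1)
      (hwg : L.IsNormal (w ++ [g])) (hc' : c.IsChain L.Forb ∧ c.length = m),
      L.differential ε γ m (chainBasis b (m + 1) ⟨⟨g :: c, hc⟩, ⟨w, hw⟩⟩) -
        chainBasis b m ⟨⟨c, hc'⟩, ⟨w ++ [g], hwg⟩⟩ ∈ Submodule.span K
        (chainBasis b m '' {y | chainWeight m y < L.weight (g :: c) + L.weight w}) := by
    intro m g c w hw hc hwg hc'
    have := hγ.smul_boundary_mem hb (m := m) (w := w) hc.1
    rw [← differential_gen hc.1 hc.2, ← map_smul] at this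
    rwa [chainBasis_apply, chainBasis_apply, hb, hb, ← mul_one (List.prod _), ← smul_eq_mul,
      ← Finsupp.smul_single, ← gen_eq, ← mul_one (List.prod (List.map γ (w ++ [g]))),
      ← smul_eq_mul, ← Finsupp.smul_single, ← gen_eq]
  have htail : ∀ c : L.ForbChain (m + 1), c.1.tail.IsChain L.Forb ∧ c.1.tail.length = m :=
    fun c => ⟨c.2.1.tail, by simp [c.2.2]⟩
  classical
  refine exact_of_triangular ((L.differential ε γ (m + 1)).restrictScalars K)
    ((L.differential ε γ m).restrictScalars K) (fun p => hγ.differential_comp m p)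
    (chainBasis b (m + 1)) (chainBasis b m) (chainWeight (m + 1)) (chainWeight m)
    {x | L.IsNormal (x.2.1 ++ x.1.1.head?.toList)}
    (fun x => ⟨⟨x.1.1.tail, htail x.1⟩, if h : L.IsNormal (x.2.1 ++ x.1.1.head?.toList) then
      ⟨x.2.1 ++ x.1.1.head?.toList, h⟩ else x.2⟩) ?_ ?_ ?_ ?_
  · rintro ⟨⟨c, hc⟩, w, hw⟩ hx ⟨⟨c', hc'⟩, w', hw'⟩ hx' heq
    match c, hc, hx, c', hc', hx', heq with
    | g :: c, hc, hx, g' :: c', hc', hx', heq =>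
      simp only [Set.mem_ofPred_eq] at hx hx'
      simp only [dif_pos hx, dif_pos hx'] at heq
      simp at heq
      obtain ⟨rfl, rfl, rfl⟩ := heq
      rfl
  · rintro ⟨⟨c, hc⟩, w, hw⟩ hx
    match c, hc, hx with
    | g :: c, hc, hx =>
      simp only [Set.mem_ofPred_eq] at hx
      simp only [dif_pos hx, chainWeight]
      simp
      omega
  · rintro ⟨⟨c, hc⟩, w, hw⟩ hx
    match c, hc, hx with
    | g :: c, hc, hx =>
      simp only [Set.mem_ofPred_eq] at hx
      simp only [dif_pos hx]
      exact key hw hc hx _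
  · rintro ⟨⟨c, hc⟩, w, hw⟩ hx
    match c, hc, hx with
    | g :: c, hc, hx =>
      simp only [Set.mem_ofPred_eq, List.head?_cons, Option.toList_some] at hx
      -- The last letter a of the word forms a forbidden pair with g, so it can be moved onto the
      -- chain: v[agc] maps to (va)[gc] plus lower terms.
      obtain ⟨v, a, rfl, hf⟩ := exists_forb_of_not_isNormal hw hx
      have hac : (a :: g :: c).IsChain L.Forb ∧ (a :: g :: c).length = m + 1 + 1 :=
        ⟨List.isChain_cons_cons.2 ⟨hf, hc.1⟩, by simpa using hc.2⟩
      refine ⟨chainBasis b (m + 2) ⟨⟨a :: g :: c, hac⟩, ⟨v, hw.dropLast⟩⟩, ?_⟩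
      have := key hw.dropLast hac hw hc
      have hwt : chainWeight (m + 1) ⟨⟨g :: c, hc⟩, ⟨v ++ [a], hw⟩⟩ =
          L.weight (a :: g :: c) + L.weight v := by
        simp [chainWeight]
        ring
      rw [hwt]
      exact this

end Basis

end LevelAlphabet

/-! ### The grading by word length and Koszulity. -/

namespace LevelAlphabet

open Module

variable {G : Type*} {L : LevelAlphabet G} {K R : Type*} [Field K] [Ring R] [Algebra K R]
  {ε : K} {γ : G → R} {b : Basis {w : List G // L.IsNormal w} K R}

variable (L K γ) in
/-- The span of the normal words of length `n`. -/
def lengthSpan (n : ℕ) : Submodule K R :=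
  Submodule.span K {x | ∃ w, L.IsNormal w ∧ w.length = n ∧ x = (w.map γ).prod}

theorem normalSpan_le_lengthSpan (n l : ℕ) : L.normalSpan K γ n l ≤ L.lengthSpan K γ n :=
  Submodule.span_mono fun _ ⟨w, hw, hn, _, hx⟩ => ⟨w, hw, hn, hx⟩

theorem Rel.prod_mem_lengthSpan (hγ : L.Rel ε γ) (w : List G) :
    (w.map γ).prod ∈ L.lengthSpan K γ w.length :=
  normalSpan_le_lengthSpan _ _ (hγ.prod_mem w)

theorem Rel.gradedMonoid (hγ : L.Rel ε γ) : SetLike.GradedMonoid (L.lengthSpan K γ) where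
  one_mem := Submodule.subset_span ⟨[], isNormal_nil, rfl, by simp⟩
  mul_mem i j x y hx hy := by
    have h := Submodule.mul_mem_mul hx hy
    rw [lengthSpan, lengthSpan, Submodule.span_mul_span] at h
    refine (Submodule.span_le.2 ?_ : _ ≤ L.lengthSpan K γ (i + j)) h
    rintro _ ⟨_, ⟨v, _, rfl, rfl⟩, _, ⟨w, _, rfl, rfl⟩, rfl⟩
    simpa using hγ.prod_mem_lengthSpan (v ++ w)

theorem lengthSpan_zero : L.lengthSpan K γ 0 = Submodule.span K {1} := by
  rw [lengthSpan]
  congr 1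
  ext x
  constructor
  · rintro ⟨w, _, hn, rfl⟩
    simp [List.length_eq_zero_iff.1 hn]
  · rintro rfl
    exact ⟨[], isNormal_nil, rfl, by simp⟩

theorem lengthSpan_eq (hb : ∀ w, b w = (w.1.map γ).prod) (n : ℕ) :
    L.lengthSpan K γ n = Submodule.span K (b '' {w | w.1.length = n}) := by
  rw [lengthSpan]
  congr 1
  ext x
  constructor
  · rintro ⟨w, hw, hn, rfl⟩
    exact ⟨⟨w, hw⟩, hn, hb _⟩
  · rintro ⟨w, hn, rfl⟩
    exact ⟨w.1, w.2, hn, hb _⟩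

theorem isInternal_lengthSpan (hb : ∀ w, b w = (w.1.map γ).prod) :
    DirectSum.IsInternal (L.lengthSpan K γ) := by
  refine DirectSum.isInternal_submodule_of_iSupIndep_of_iSup_eq_top ?_ ?_
  · intro i
    have h := b.linearIndependent.disjoint_span_image (s := {w | w.1.length = i})
      (t := {w | w.1.length ≠ i}) (Set.disjoint_left.2 fun w h1 h2 => h2 h1)
    rw [lengthSpan_eq hb]
    refine h.mono_right (iSup₂_le fun j hj => ?_)
    rw [lengthSpan_eq hb]
    refine Submodule.span_mono (Set.image_mono fun w hw => ?_)
    rw [Set.mem_ofPred_eq] at hw ⊢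
    rwa [hw]
  · rw [eq_top_iff, ← b.span_eq, Submodule.span_le]
    rintro _ ⟨w, rfl⟩
    refine Submodule.mem_iSup_of_mem w.1.length ?_
    rw [lengthSpan_eq hb]
    exact Submodule.subset_span ⟨w, rfl, rfl⟩

theorem letter_mem_lengthSpan (g : G) : γ g ∈ L.lengthSpan K γ 1 :=
  Submodule.subset_span ⟨[g], isNormal_singleton g, rfl, by simp⟩

theorem smul_gen_apply_mem {a : R} {n : ℕ} (ha : a ∈ L.lengthSpan K γ n) (m : ℕ) (c : List G)
    (c' : L.ForbChain m) : (a • L.gen R m c) c' ∈ L.lengthSpan K γ n := by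
  classical
  rw [gen]
  split_ifs with h
  · rw [Finsupp.smul_single, Finsupp.single_apply]
    split_ifs
    · simpa using ha
    · exact zero_mem _
  · simp

theorem boundary_apply_mem (m : ℕ) (c : List G) (c' : L.ForbChain m) :
    L.boundary ε γ m c c' ∈ L.lengthSpan K γ 1 := by
  have hg := letter_mem_lengthSpan (L := L) (K := K) (γ := γ)
  match c with
  | [] => simp [boundary]
  | [g] => exact smul_gen_apply_mem (hg g) m _ c'
  | g :: h :: c =>
    rw [boundary]
    split_ifs
    · rw [Finsupp.sub_apply]
      exact sub_mem
        (smul_gen_apply_mem (sub_mem (hg g) (Submodule.smul_mem _ _ (hg h))) m _ c')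
        (smul_gen_apply_mem (Submodule.smul_mem _ _ (hg h)) m _ c')
    · exact smul_gen_apply_mem (hg g) m _ c'

/-- This is exactness at the zeroth module, which is free on the empty chain. A word of positive
length ends in a letter g, so it is v g, the image of v[g]. Hence the letters generate the positive
part as a left ideal. -/
theorem mem_irrelevantIdeal_iff (x : L.ForbChain 0 →₀ R) :
    x ⟨[], List.isChain_nil, rfl⟩ ∈ irrelevantIdeal (L.lengthSpan K γ) ↔
      x ∈ LinearMap.range (L.differential ε γ 0) := by
  have huniq : ∀ c : L.ForbChain 0, c = ⟨[], List.isChain_nil, rfl⟩ := fun c =>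
    Subtype.ext (List.length_eq_zero_iff.1 c.2.2)
  have hx : ∀ x : L.ForbChain 0 →₀ R,
      x = x ⟨[], List.isChain_nil, rfl⟩ • L.gen R 0 [] := by
    intro x
    ext c
    rw [huniq c, gen, dif_pos ⟨List.isChain_nil, rfl⟩]
    simp
  constructor
  · intro h
    rw [hx x]
    generalize x ⟨[], List.isChain_nil, rfl⟩ = a at h
    induction h using Submodule.span_induction with
    | zero => simp
    | add x y _ _ hx hy => rw [add_smul]; exact add_mem hx hy
    | smul r x _ hx => rw [smul_assoc]; exact Submodule.smul_mem _ _ hx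
    | mem a ha =>
      obtain ⟨n, ha⟩ := ha
      induction ha using Submodule.span_induction with
      | zero => simp
      | add x y _ _ hx hy => rw [add_smul]; exact add_mem hx hy
      | smul r x _ hx =>
        rw [smul_assoc, ← algebraMap_smul R r]
        exact Submodule.smul_mem _ _ hx
      | mem a ha =>
        obtain ⟨w, _, hn, rfl⟩ := ha
        rcases List.eq_nil_or_concat w with rfl | ⟨v, g, rfl⟩
        · simp at hn
        · refine ⟨(v.map γ).prod • L.gen R 1 [g], ?_⟩
          rw [map_smul, differential_gen (m := 0) (List.isChain_singleton g) rfl, boundary, ← mul_smul]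
          simp
  · rintro ⟨y, rfl⟩
    induction y using Finsupp.induction_linear with
    | zero => simp
    | add x y hx hy => rw [map_add, Finsupp.add_apply]; exact add_mem hx hy
    | single c r =>
      rw [differential, Finsupp.linearCombination_single, Finsupp.smul_apply]
      exact Submodule.smul_mem _ _ (Submodule.subset_span ⟨0, boundary_apply_mem 0 c.1 _⟩)

universe uG

/-- An algebra with the rewriting rules of a levelled alphabet in which the normal words form a
basis is Koszul. -/
theorem Rel.isKoszul {G : Type uG} {L : LevelAlphabet G} {K : Type uK} {R : Type uA} [Field K]
    [Ring R] [Algebra K R] {ε : K} {γ : G → R} {b : Basis {w : List G // L.IsNormal w} K R}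
    (hγ : L.Rel ε γ) (hb : ∀ w, b w = (w.1.map γ).prod) : IsKoszul K R (L.lengthSpan K γ) where
  nontrivial := ⟨b ⟨[], isNormal_nil⟩, 0, b.ne_zero _⟩
  gradedMonoid := hγ.gradedMonoid
  isInternal := isInternal_lengthSpan hb
  connected := lengthSpan_zero
  linearResolution := by
    -- The generating sets must lie in the universe of the algebra, whereas the alphabet may not.
    -- Letters are distinct basis vectors, so the alphabet is small relative to that universe, and
    -- so are the sets of chains.
    have hinj : Function.Injective γ := fun g h hgh => by
      have : b ⟨[g], isNormal_singleton g⟩ = b ⟨[h], isNormal_singleton h⟩ := by simpa [hb]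
      simpa using b.injective this
    have : Small.{uA} G := small_of_injective hinj
    let e : ∀ m, (Shrink.{uA} (L.ForbChain m) →₀ R) ≃ₗ[R] (L.ForbChain m →₀ R) := fun m =>
      Finsupp.domLCongr (equivShrink (L.ForbChain m)).symm
    let p : (L.ForbChain 0 →₀ R) →ₗ[R] R ⧸ irrelevantIdeal (L.lengthSpan K γ) :=
      (Submodule.mkQ (irrelevantIdeal (L.lengthSpan K γ))).comp
        (Finsupp.lapply ⟨[], List.isChain_nil, rfl⟩)
    refine ⟨fun m => Shrink.{uA} (L.ForbChain m),
      fun m => (e m).symm.toLinearMap ∘ₗ L.differential ε γ m ∘ₗ (e (m + 1)).toLinearMap,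
      p ∘ₗ (e 0).toLinearMap, ?_, ?_, ?_, ?_⟩
    · refine Function.Surjective.comp (g := p) ?_ (e 0).surjective
      refine Function.Surjective.comp (g := Submodule.mkQ _) (Submodule.mkQ_surjective _) ?_
      exact fun a => ⟨Finsupp.single ⟨[], List.isChain_nil, rfl⟩ a, by simp⟩
    · intro x
      obtain ⟨x, rfl⟩ := (e 0).symm.surjective x
      have h1 : (p ∘ₗ (e 0).toLinearMap) ((e 0).symm x) = 0 ↔
          x ∈ LinearMap.range (L.differential ε γ 0) := by
        rw [← mem_irrelevantIdeal_iff x]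
        simp [p]
      rw [h1]
      constructor
      · rintro ⟨y, rfl⟩
        exact ⟨(e 1).symm y, by simp⟩
      · rintro ⟨y, hy⟩
        exact ⟨e 1 y, (e 0).symm.injective hy⟩
    · intro i x
      obtain ⟨x, rfl⟩ := (e (i + 1)).symm.surjective x
      have h1 := hγ.differential_exact hb i x
      have h2 : ((e i).symm.toLinearMap ∘ₗ L.differential ε γ i ∘ₗ (e (i + 1)).toLinearMap)
          ((e (i + 1)).symm x) = 0 ↔ L.differential ε γ i x = 0 := by simp
      rw [h2, h1]
      constructor
      · rintro ⟨y, rfl⟩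
        exact ⟨(e (i + 2)).symm y, by simp⟩
      · rintro ⟨y, hy⟩
        exact ⟨e (i + 2) y, (e (i + 1)).symm.injective hy⟩
    · intro i c c'
      have : ((e i).symm.toLinearMap ∘ₗ L.differential ε γ i ∘ₗ (e (i + 1)).toLinearMap)
          (Finsupp.single c 1) c' =
          L.boundary ε γ i ((equivShrink _).symm c).1 ((equivShrink _).symm c') := by
        simp [e, differential, Finsupp.domLCongr_symm]
      rw [this]
      exact boundary_apply_mem _ _ _

end LevelAlphabet

/-! ### Independence of normal words through an action. -/

namespace LevelAlphabet

variable {G : Type*} (L : LevelAlphabet G) (K : Type*) [Field K]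

open Classical in
/-- The basis vector given by a word (zero if the word is not normal). -/
noncomputable def wordVector (w : List G) : {w : List G // L.IsNormal w} →₀ K :=
  if h : L.IsNormal w then Finsupp.single ⟨w, h⟩ 1 else 0

open Classical in
/-- The vector obtained by letting a letter act on a normal word. -/
noncomputable def letterAct (g : G) : List G → ({w : List G // L.IsNormal w} →₀ K)
  | [] => L.wordVector K [g]
  | h :: w =>
    if L.Forb g h then
      if L.base g = g then L.wordVector K (h :: h :: w) + L.wordVector K (h :: L.base h :: w)
      else 0
    else L.wordVector K (g :: h :: w)

/-- The action of a letter on the space spanned by the normal words. -/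
noncomputable def letterEnd (g : G) : Module.End K ({w : List G // L.IsNormal w} →₀ K) :=
  Finsupp.linearCombination K fun w => L.letterAct K g w.1

variable {L K}

theorem letterEnd_wordVector (g : G) {w : List G} (hw : L.IsNormal w) :
    L.letterEnd K g (L.wordVector K w) = L.letterAct K g w := by
  rw [wordVector, dif_pos hw, letterEnd, Finsupp.linearCombination_single, one_smul]

theorem letterAct_of_isNormal {g : G} {w : List G} (hw : L.IsNormal (g :: w)) :
    L.letterAct K g w = L.wordVector K (g :: w) := by
  cases w with
  | nil => rfl
  | cons h w => rw [letterAct, if_neg (isNormal_cons_cons.1 hw).1]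

/-- Since non-normal words have vector zero, a letter that is not a base letter acts simply by
prepending itself, without case distinction. -/
theorem letterEnd_wordVector_of_base_ne {g : G} (hg : L.base g ≠ g) {w : List G}
    (hw : L.IsNormal w) : L.letterEnd K g (L.wordVector K w) = L.wordVector K (g :: w) := by
  rw [letterEnd_wordVector _ hw]
  cases w with
  | nil => rfl
  | cons h w =>
    by_cases hf : L.Forb g h
    · rw [letterAct, if_pos hf, if_neg hg, wordVector, dif_neg]
      exact fun hn => (isNormal_cons_cons.1 hn).1 hf
    · rw [letterAct, if_neg hf]

theorem hom_ext_wordVector {M : Type*} [AddCommGroup M] [Module K M]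
    {f g : ({w : List G // L.IsNormal w} →₀ K) →ₗ[K] M}
    (h : ∀ w, L.IsNormal w → f (L.wordVector K w) = g (L.wordVector K w)) : f = g := by
  refine Finsupp.lhom_ext' fun w => LinearMap.ext_ring ?_
  simpa [wordVector, dif_pos w.2] using h w.1 w.2

-- This is the confluence check. Only overlaps ghk with gh and hk both forbidden need an argument,
-- and both sides vanish there.
variable (L K) in
theorem rel_letterEnd : L.Rel (1 : K) (L.letterEnd K) where
  mul_eq_zero {g h} hf hg := by
    refine hom_ext_wordVector fun w hw => ?_
    rw [Module.End.mul_apply, letterEnd_wordVector_of_base_ne hf.1 hw, LinearMap.zero_apply]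
    by_cases hn : L.IsNormal (h :: w)
    · rw [letterEnd_wordVector _ hn, letterAct, if_pos hf, if_neg hg]
    · rw [wordVector, dif_neg hn, map_zero]
  mul_eq {g h} hf hg := by
    refine hom_ext_wordVector fun w hw => ?_
    have hh : L.base h ≠ h := hf.1
    rw [one_smul, LinearMap.add_apply, Module.End.mul_apply, Module.End.mul_apply,
      Module.End.mul_apply, letterEnd_wordVector_of_base_ne hh hw]
    by_cases hn : L.IsNormal (h :: w)
    · rw [letterEnd_wordVector _ hn, letterAct, if_pos hf, if_pos hg,
        letterEnd_wordVector_of_base_ne hh hn, letterEnd_wordVector _ hw,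
        letterAct_of_isNormal (hn.cons_of_level_eq (L.level_base h).symm),
        letterEnd_wordVector_of_base_ne hh (hn.cons_of_level_eq (L.level_base h).symm)]
    -- Overlap case: w starts with k and hk is forbidden. The base letter of h turns kw' into kkw' +
    -- kk'w' with k' = base k, and prepending h to either word gives a non-normal word, hence zero.
    · have hz : L.wordVector K (h :: w) = 0 := by rw [wordVector, dif_neg hn]
      rw [hz, map_zero, map_zero, zero_add]
      cases w with
      | nil => exact absurd (isNormal_singleton h) hn
      | cons k w =>
        have hk : L.Forb h k := by
          by_contra hk
          exact hn (isNormal_cons_cons.2 ⟨hk, hw⟩)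
        have hz : ∀ v, L.wordVector K (h :: k :: v) = 0 := fun v => by
          rw [wordVector, dif_neg]
          exact fun hv => (isNormal_cons_cons.1 hv).1 hk
        rw [letterEnd_wordVector _ hw, letterAct,
          if_pos ((forb_congr (L.level_base h)).2 hk), if_pos (base_base h), map_add,
          letterEnd_wordVector_of_base_ne hh hw.double,
          letterEnd_wordVector_of_base_ne hh hw.cons_base, hz, hz, add_zero]

theorem prod_letterEnd_wordVector {w : List G} (hw : L.IsNormal w) :
    (w.map (L.letterEnd K)).prod (L.wordVector K []) = L.wordVector K w := by
  induction w with
  | nil => simp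
  | cons g w ih =>
    rw [List.map_cons, List.prod_cons, Module.End.mul_apply, ih hw.tail,
      letterEnd_wordVector _ hw.tail, letterAct_of_isNormal hw]

/-- The normal words are linearly independent in every algebra that acts on them by the action of
the letters. -/
theorem linearIndependent_of_algHom {R : Type*} [Ring R] [Algebra K R] {γ : G → R}
    (ρ : R →ₐ[K] Module.End K ({w : List G // L.IsNormal w} →₀ K))
    (hρ : ∀ g, ρ (γ g) = L.letterEnd K g) :
    LinearIndependent K fun w : {w : List G // L.IsNormal w} => (w.1.map γ).prod := by
  refine LinearIndependent.of_comp
    ((LinearMap.applyₗ (L.wordVector K [])).comp ρ.toLinearMap) ?_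
  convert Finsupp.linearIndependent_single_one K {w : List G // L.IsNormal w} using 1
  funext w
  have h : ρ (w.1.map γ).prod = (w.1.map (L.letterEnd K)).prod := by
    rw [map_list_prod, List.map_map]
    congr 2
    funext g
    exact hρ g
  change ρ (w.1.map γ).prod (L.wordVector K []) = _
  rw [h, prod_letterEnd_wordVector w.2, wordVector, dif_pos w.2]

end LevelAlphabet

/-! ### Path polynomials and relations from short paths. -/

namespace LayeredGraph

variable {V : Type uV} {E : Type uE} (Γ : LayeredGraph V E)

theorem IsPath.level_eq {v w : V} {π : List E} (h : Γ.IsPath v w π) :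
    Γ.level v = Γ.level w + π.length := by
  induction h with
  | single e => exact Γ.level_tail e
  | cons e h ih => rw [Γ.level_tail, ih, List.length_cons]; ring

theorem IsPath.exists_length_eq {v w : V} {π : List E} (h : Γ.IsPath v w π) :
    ∃ m, π.length = m + 1 := by
  cases h <;> simp

/-- The products `T i * T (i - 1) * ⋯ * (T (i - m + 1) + a)` of `m` factors. -/
def descProd {S : Type*} [Ring S] (T : ℕ → S) (a : S) : ℕ → ℕ → S
  | _, 0 => 1
  | i, 1 => T i + a
  | i, m + 2 => T i * descProd T a (i - 1) (m + 1)

/-- Under the displayed relations, the product of linear factors along a path only depends on the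
end points of the path. -/
theorem IsPath.prod_eq {S : Type*} [Ring S] (T : ℕ → S) (y : V → S)
    (h₁ : ∀ v u, Γ.level v = Γ.level u + 1 → y v * y u = 0)
    (h₂ : ∀ v u, Γ.level v = Γ.level u + 1 →
      T (Γ.level v) * y u = y u * T (Γ.level u) - y u * y u)
    {v w : V} {π : List E} (h : Γ.IsPath v w π) :
    (π.map fun e => T (Γ.level (Γ.tail e)) - y (Γ.tail e) + y (Γ.head e)).prod =
      descProd T (y w) (Γ.level v) π.length -
        y v * descProd T (y w) (Γ.level v - 1) (π.length - 1) := by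
  induction h with
  | single e => simp [descProd]; abel
  | @cons e w π h ih =>
    rw [List.map_cons, List.prod_cons, ih]
    have hl := Γ.level_tail e
    obtain ⟨m, hm⟩ := h.exists_length_eq
    -- For a path of one edge the last factor is T + y w rather than T; the extra term is killed by
    -- y (head e) * y w = 0.
    have key : y (Γ.head e) * descProd T (y w) (Γ.level (Γ.head e)) π.length =
        y (Γ.head e) * (T (Γ.level (Γ.head e)) *
          descProd T (y w) (Γ.level (Γ.head e) - 1) (π.length - 1)) := by
      rw [hm]
      cases m with
      | zero =>
        have hw := h.level_eq
        rw [hm] at hw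
        simp [descProd, mul_add, h₁ _ _ hw]
      | succ m => rfl
    have hD : descProd T (y w) (Γ.level (Γ.tail e)) (e :: π).length =
        T (Γ.level (Γ.tail e)) * descProd T (y w) (Γ.level (Γ.head e)) π.length := by
      rw [List.length_cons, hm, hl]
      rfl
    have hD' : Γ.level (Γ.tail e) - 1 = Γ.level (Γ.head e) := by omega
    rw [hD, hD', List.length_cons, Nat.add_sub_cancel]
    generalize descProd T (y w) (Γ.level (Γ.head e)) π.length = D at *
    generalize descProd T (y w) (Γ.level (Γ.head e) - 1) (π.length - 1) = D' at *
    -- The relation `h₂` absorbs the y² term created by y (head e), so the contributions of the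
    -- intermediate vertex cancel.
    have e1 : (T (Γ.level (Γ.tail e)) - y (Γ.tail e) + y (Γ.head e)) * (y (Γ.head e) * D') =
        y (Γ.head e) * (T (Γ.level (Γ.head e)) * D') := by
      rw [← mul_assoc, add_mul, sub_mul, h₁ _ _ hl, h₂ _ _ hl, sub_zero, sub_add_cancel, mul_assoc]
    rw [mul_sub, e1, ← key, add_mul, sub_mul, add_sub_cancel_right]

variable (K : Type uK) [Field K]

variable {K} in
/-- A function on edges whose path polynomials only depend on the end points of the path extends
to the splitting algebra. -/
noncomputable def liftSplitting {R : Type*} [Ring R] [Algebra K R] (f : E → R)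
    (hf : ∀ {v w : V} {π₁ π₂ : List E}, Γ.IsPath v w π₁ → Γ.IsPath v w π₂ →
      (π₁.map fun e => Polynomial.X - Polynomial.C (f e)).prod =
        (π₂.map fun e => Polynomial.X - Polynomial.C (f e)).prod) :
    Γ.SplittingAlgebra K →ₐ[K] R :=
  RingQuot.liftAlgHom K ⟨FreeAlgebra.lift K f, by
    have hmap : ∀ (π : List E), (pathPoly K π).map (FreeAlgebra.lift K f : FreeAlgebra K E →+* R) =
        (π.map fun e => Polynomial.X - Polynomial.C (f e)).prod := by
      intro π
      rw [pathPoly, ← Polynomial.coe_mapRingHom, map_list_prod, List.map_map]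
      congr 2
      funext e
      simp
    rintro _ _ ⟨h₁, h₂, k⟩
    have h := congrArg (fun p => Polynomial.coeff p k) (hf h₁ h₂)
    simp only [← hmap, Polynomial.coeff_map] at h
    exact h⟩

theorem liftSplitting_edge {R : Type*} [Ring R] [Algebra K R] (f : E → R) (hf) (e : E) :
    Γ.liftSplitting f hf (Γ.edge K e) = f e := by
  rw [liftSplitting, edge]
  erw [RingQuot.liftAlgHom_mkAlgHom_apply]
  simp

/-- The quotient map from the free algebra on the edges to the splitting algebra. -/
noncomputable def edgeHom : FreeAlgebra K E →ₐ[K] Γ.SplittingAlgebra K :=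
  RingQuot.mkAlgHom K (Γ.SplittingRel K)

theorem edgeHom_surjective : Function.Surjective (Γ.edgeHom K) :=
  RingQuot.mkAlgHom_surjective K (Γ.SplittingRel K)

theorem edgeHom_ι (e : E) : Γ.edgeHom K (FreeAlgebra.ι K e) = Γ.edge K e := rfl

theorem pathPoly_edge_eq {v w : V} {π₁ π₂ : List E} (h₁ : Γ.IsPath v w π₁)
    (h₂ : Γ.IsPath v w π₂) :
    (π₁.map fun e => Polynomial.X - Polynomial.C (Γ.edge K e)).prod =
      (π₂.map fun e => Polynomial.X - Polynomial.C (Γ.edge K e)).prod := by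
  have hmap : ∀ (π : List E), (pathPoly K π).map
      (Γ.edgeHom K : FreeAlgebra K E →+* Γ.SplittingAlgebra K) =
        (π.map fun e => Polynomial.X - Polynomial.C (Γ.edge K e)).prod := by
    intro π
    rw [pathPoly, ← Polynomial.coe_mapRingHom, map_list_prod, List.map_map]
    congr 2
    funext e
    simp [edgeHom_ι]
  rw [← hmap, ← hmap]
  ext k
  rw [Polynomial.coeff_map, Polynomial.coeff_map]
  exact RingQuot.mkAlgHom_rel K (SplittingRel.coeff h₁ h₂ k)

theorem edge_eq_of_parallel {e e' : E} (ht : Γ.tail e = Γ.tail e') (hh : Γ.head e = Γ.head e') :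
    Γ.edge K e = Γ.edge K e' := by
  have h := Γ.pathPoly_edge_eq K (IsPath.single e) (by rw [ht, hh]; exact IsPath.single e')
  simpa using h

/-- These are the coefficients of t and 1 in two quadratic path polynomials. Together with parallel
edges they are the only relations needed for the rewriting rules. -/
theorem edge_add_mul_eq {e f e' f' : E} (h₁ : Γ.head e = Γ.tail f) (h₂ : Γ.head e' = Γ.tail f')
    (ht : Γ.tail e = Γ.tail e') (hh : Γ.head f = Γ.head f') :
    Γ.edge K e + Γ.edge K f = Γ.edge K e' + Γ.edge K f' ∧
      Γ.edge K e * Γ.edge K f = Γ.edge K e' * Γ.edge K f' := by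
  have p₁ : Γ.IsPath (Γ.tail e) (Γ.head f) [e, f] := by
    refine IsPath.cons e ?_
    rw [h₁]
    exact IsPath.single f
  have p₂ : Γ.IsPath (Γ.tail e) (Γ.head f) [e', f'] := by
    rw [ht, hh]
    refine IsPath.cons e' ?_
    rw [h₂]
    exact IsPath.single f'
  have h := Γ.pathPoly_edge_eq K p₁ p₂
  have hexp : ∀ a b : Γ.SplittingAlgebra K,
      (Polynomial.X - Polynomial.C a) * (Polynomial.X - Polynomial.C b) =
      Polynomial.X ^ 2 - Polynomial.C (a + b) * Polynomial.X + Polynomial.C (a * b) := by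
    intro a b
    rw [mul_sub, sub_mul, sub_mul, Polynomial.X_mul_C, map_add, map_mul, sq, add_mul]
    abel
  simp only [List.map_cons, List.map_nil, List.prod_cons, List.prod_nil, mul_one, hexp] at h
  have c0 := congrArg (fun p => Polynomial.coeff p 0) h
  have c1 := congrArg (fun p => Polynomial.coeff p 1) h
  simp [Polynomial.coeff_X_pow, Polynomial.coeff_C] at c0 c1
  exact ⟨by rw [← neg_inj, neg_add_rev, neg_add_rev]; simpa using c1, c0⟩

end LayeredGraph

/-! ### The alphabet of vertices of positive level. -/

namespace LayeredGraph

open LevelAlphabet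

variable {V : Type uV} {E : Type uE} (Γ : LayeredGraph V E) (star : V)

open Classical in
/-- A distinguished vertex on each level. -/
noncomputable def basePoint (i : ℕ) : V := if h : ∃ v, Γ.level v = i then h.choose else star

theorem level_basePoint (v : V) : Γ.level (Γ.basePoint star (Γ.level v)) = Γ.level v := by
  have h : ∃ u, Γ.level u = Γ.level v := ⟨v, rfl⟩
  rw [basePoint, dif_pos h]
  exact h.choose_spec

variable (hlevel : ∀ v, Γ.level v = 0 ↔ v = star)

/-- The vertices of positive level as a levelled alphabet. -/
noncomputable def alphabet : LevelAlphabet {v : V // v ≠ star} where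
  level v := Γ.level v
  base v := ⟨Γ.basePoint star (Γ.level v), fun h => v.2 ((hlevel _).1 (by
    rw [← Γ.level_basePoint star, h]; exact (hlevel _).2 rfl))⟩
  level_base v := Γ.level_basePoint star v
  base_eq {g h} hl := Subtype.ext (congrArg (Γ.basePoint star) hl)

variable {star}

theorem alphabet_level (v) : (Γ.alphabet star hlevel).level v = Γ.level v := rfl

theorem alphabet_base (v) :
    ((Γ.alphabet star hlevel).base v : V) = Γ.basePoint star (Γ.level v) := rfl

variable {K : Type uK} [Field K]

/-! ### From the rewriting rules back to the splitting relations. -/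

section Representation

variable {R : Type*} [Ring R] [Algebra K R] (γ : {v : V // v ≠ star} → R)

open Classical in
/-- The value of `γ` at the vertices that are not distinguished, and zero at the others. -/
noncomputable def offBase (v : V) : R :=
  if h : v ≠ star ∧ Γ.basePoint star (Γ.level v) ≠ v then γ ⟨v, h.1⟩ else 0

open Classical in
/-- The value of `γ` at the distinguished vertex of a level. -/
noncomputable def onBase (i : ℕ) : R :=
  if h : Γ.basePoint star i ≠ star then γ ⟨Γ.basePoint star i, h⟩ else 0

/-- The image of an edge in an algebra in which the vertices are given. -/
noncomputable def edgeImage (e : E) : R :=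
  Γ.offBase γ (Γ.tail e) - Γ.offBase γ (Γ.head e) + Γ.onBase γ (Γ.level (Γ.tail e))

variable {γ} (hγ : (Γ.alphabet star hlevel).Rel (1 : K) γ)

include hlevel in
theorem ne_star_of_level {v u : V} (h : Γ.level v = Γ.level u + 1) : v ≠ star := fun hv => by
  have := (hlevel v).2 hv
  omega

theorem offBase_basePoint (i : ℕ) : Γ.offBase γ (Γ.basePoint star i) = 0 := by
  rw [offBase, dif_neg]
  rintro ⟨h1, h2⟩
  refine h2 ?_
  by_cases hi : ∃ v, Γ.level v = i
  · obtain ⟨v, rfl⟩ := hi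
    rw [level_basePoint]
  · rw [basePoint, dif_neg hi] at h1
    exact absurd rfl h1

theorem edgeImage_of_head_eq {e : E} {i : ℕ} (he : Γ.head e = Γ.basePoint star i) :
    Γ.edgeImage γ e = Γ.offBase γ (Γ.tail e) + Γ.onBase γ (Γ.level (Γ.tail e)) := by
  rw [edgeImage, he, offBase_basePoint, sub_zero]

theorem onBase_level (v : {v : V // v ≠ star}) :
    Γ.onBase γ (Γ.level v) = γ ((Γ.alphabet star hlevel).base v) := by
  exact dif_pos ((Γ.alphabet star hlevel).base v).2

include hγ

theorem offBase_mul_offBase {v u : V} (h : Γ.level v = Γ.level u + 1) :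
    Γ.offBase γ v * Γ.offBase γ u = 0 := by
  by_cases hu : u ≠ star ∧ Γ.basePoint star (Γ.level u) ≠ u
  · by_cases hv : v ≠ star ∧ Γ.basePoint star (Γ.level v) ≠ v
    · rw [offBase, offBase, dif_pos hu, dif_pos hv]
      refine hγ.mul_eq_zero ⟨fun hb => hu.2 (congrArg Subtype.val hb), h⟩
        fun hb => hv.2 (congrArg Subtype.val hb)
    · rw [offBase, dif_neg hv, zero_mul]
  · rw [offBase, offBase, dif_neg hu, mul_zero]

theorem onBase_mul_offBase {v u : V} (h : Γ.level v = Γ.level u + 1) :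
    Γ.onBase γ (Γ.level v) * Γ.offBase γ u =
      Γ.offBase γ u * Γ.offBase γ u + Γ.offBase γ u * Γ.onBase γ (Γ.level u) := by
  by_cases hu : u ≠ star ∧ Γ.basePoint star (Γ.level u) ≠ u
  · have hv := Γ.ne_star_of_level hlevel h
    have hf : (Γ.alphabet star hlevel).Forb ((Γ.alphabet star hlevel).base ⟨v, hv⟩) ⟨u, hu.1⟩ :=
      (forb_congr (level_base _ _)).2 ⟨fun hb => hu.2 (congrArg Subtype.val hb), h⟩
    have hrel := hγ.mul_eq hf (base_base _)
    rw [one_smul] at hrel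
    rw [Γ.onBase_level hlevel ⟨v, hv⟩, Γ.onBase_level hlevel ⟨u, hu.1⟩, offBase, dif_pos hu, hrel]
  · rw [offBase, dif_neg hu]
    simp

/-- With T i = t - onBase i and y = offBase, the factor t - edgeImage e has the form treated in
`IsPath.prod_eq`. The resulting value depends only on the end points and the length, and the levels
of the end points fix the length. -/
theorem prod_edgeImage_eq {v w : V} {π₁ π₂ : List E} (h₁ : Γ.IsPath v w π₁)
    (h₂ : Γ.IsPath v w π₂) :
    (π₁.map fun e => Polynomial.X - Polynomial.C (Γ.edgeImage γ e)).prod =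
      (π₂.map fun e => Polynomial.X - Polynomial.C (Γ.edgeImage γ e)).prod := by
  have key : ∀ π, Γ.IsPath v w π → _ := fun π h => h.prod_eq (Γ := Γ)
    (fun i => Polynomial.X - Polynomial.C (Γ.onBase γ i))
    (fun v => Polynomial.C (Γ.offBase γ v))
    (fun v u hl => by rw [← map_mul, Γ.offBase_mul_offBase hlevel hγ hl, map_zero])
    (fun v u hl => by
      rw [sub_mul, mul_sub, Polynomial.X_mul_C, ← map_mul, ← map_mul, ← map_mul,
        Γ.onBase_mul_offBase hlevel hγ hl, map_add]
      abel)
  have hlen : π₁.length = π₂.length := by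
    have := h₁.level_eq
    have := h₂.level_eq
    omega
  have hmap : (fun e => Polynomial.X - Polynomial.C (Γ.edgeImage γ e)) = fun e =>
      Polynomial.X - Polynomial.C (Γ.onBase γ (Γ.level (Γ.tail e))) -
        Polynomial.C (Γ.offBase γ (Γ.tail e)) + Polynomial.C (Γ.offBase γ (Γ.head e)) := by
    funext e
    rw [edgeImage, map_add, map_sub]
    abel
  rw [hmap, key π₁ h₁, key π₂ h₂, hlen]

end Representation

/-! ### Vertex generators and the normal basis of the splitting algebra. -/

variable (K)

open Classical in
/-- The class of an edge from a vertex to the distinguished vertex one level below. -/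
noncomputable def downEdge (star : V) (v : V) : Γ.SplittingAlgebra K :=
  if h : ∃ e, Γ.tail e = v ∧ Γ.head e = Γ.basePoint star (Γ.level v - 1) then Γ.edge K h.choose
  else 0

open Classical in
/-- The generators of the splitting algebra indexed by the vertices of positive level. -/
noncomputable def vertexGen (v : {v : V // v ≠ star}) : Γ.SplittingAlgebra K :=
  if Γ.basePoint star (Γ.level v) = v then Γ.downEdge K star v
  else Γ.downEdge K star v - Γ.downEdge K star (Γ.basePoint star (Γ.level v))

theorem vertexGen_base (v : {v : V // v ≠ star}) :
    Γ.vertexGen K ((Γ.alphabet star hlevel).base v) =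
      Γ.downEdge K star (Γ.basePoint star (Γ.level v)) :=
  if_pos (congrArg (Γ.basePoint star) (Γ.level_basePoint star v))

theorem downEdge_eq {e : E} (h : Γ.head e = Γ.basePoint star (Γ.level (Γ.tail e) - 1)) :
    Γ.downEdge K star (Γ.tail e) = Γ.edge K e := by
  have hex : ∃ e', Γ.tail e' = Γ.tail e ∧
      Γ.head e' = Γ.basePoint star (Γ.level (Γ.tail e) - 1) := ⟨e, rfl, h⟩
  rw [downEdge, dif_pos hex]
  exact Γ.edge_eq_of_parallel K hex.choose_spec.1 (hex.choose_spec.2.trans h.symm)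

include hlevel in
theorem basePoint_zero : Γ.basePoint star 0 = star := by
  rw [← hlevel, ← (hlevel star).2 rfl, level_basePoint]

include hlevel in
theorem downEdge_star : Γ.downEdge K star star = 0 := by
  rw [downEdge, dif_neg]
  rintro ⟨e, he, -⟩
  have h := Γ.level_tail e
  rw [he, (hlevel star).2 rfl] at h
  omega

theorem exists_downEdge (hcomplete : Γ.IsComplete) {v u : V} (h : Γ.level v = Γ.level u + 1) :
    ∃ e, Γ.tail e = v ∧ Γ.head e = Γ.basePoint star (Γ.level v - 1) := by
  refine hcomplete v _ ?_
  rw [h, Nat.add_sub_cancel, level_basePoint]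

include hlevel in
theorem exists_level_succ (hminimal : ∀ v, Γ.IsMinimal v ↔ v = star) {v : V}
    (hv : Γ.level v ≠ 0) : ∃ u, Γ.level v = Γ.level u + 1 := by
  have h : ¬ Γ.IsMinimal v := fun hm => hv ((hlevel v).2 ((hminimal v).1 hm))
  simp only [IsMinimal, not_forall, not_not] at h
  obtain ⟨e, rfl⟩ := h
  exact ⟨Γ.head e, Γ.level_tail e⟩

variable (hcomplete : Γ.IsComplete) (hminimal : ∀ v, Γ.IsMinimal v ↔ v = star)

include hlevel hcomplete hminimal

/-- From the tail of e to the base vertex two levels down there are two paths: through the head of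
e, and through the base vertex on the level of that head. Comparing sums and products gives both
identities. If the head is the minimal vertex, e is itself a down edge and the convention d = 0
there makes them trivial. -/
theorem edge_relations (e : E) :
    Γ.edge K e = Γ.downEdge K star (Γ.tail e) - (Γ.downEdge K star (Γ.head e) -
        Γ.downEdge K star (Γ.basePoint star (Γ.level (Γ.head e)))) ∧
      Γ.edge K e * Γ.downEdge K star (Γ.head e) = Γ.downEdge K star (Γ.tail e) *
        Γ.downEdge K star (Γ.basePoint star (Γ.level (Γ.head e))) := by
  have hl := Γ.level_tail e
  by_cases h0 : Γ.level (Γ.head e) = 0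
  · have hh := (hlevel _).1 h0
    have he := Γ.downEdge_eq K (star := star) (e := e) (by
      rw [hl, h0, hh, Nat.add_sub_cancel, Γ.basePoint_zero hlevel])
    rw [h0, Γ.basePoint_zero hlevel, hh, Γ.downEdge_star hlevel K, he]
    simp
  · obtain ⟨u, hu⟩ := Γ.exists_level_succ hlevel hminimal h0
    obtain ⟨f, hft, hfh⟩ := Γ.exists_downEdge (star := star) hcomplete hu
    obtain ⟨e', het', heh'⟩ := Γ.exists_downEdge (star := star) hcomplete hl
    have hb : Γ.level (Γ.head e') = Γ.level (Γ.head e) := by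
      rw [heh', hl, Nat.add_sub_cancel, level_basePoint]
    obtain ⟨f', hft', hfh'⟩ := Γ.exists_downEdge (star := star) hcomplete (hb.trans hu)
    obtain ⟨h1, h2⟩ := Γ.edge_add_mul_eq K hft.symm hft'.symm het'.symm
      (hfh.trans (by rw [hfh', hb]))
    have k1 := Γ.downEdge_eq K (star := star) (e := f) (by rw [hfh, hft])
    have k2 := Γ.downEdge_eq K (star := star) (e := e') (by rw [heh', het'])
    have k3 := Γ.downEdge_eq K (star := star) (e := f') (by rw [hfh', hft'])
    rw [hft] at k1
    rw [het'] at k2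
    rw [hft', heh', hl, Nat.add_sub_cancel] at k3
    rw [k1, k2, k3]
    exact ⟨by rw [eq_sub_iff_add_eq, add_sub, h1, add_sub_cancel_right], h2⟩

/-- Eliminating the edge e = d_g - x_h from e d_h = d_g d_b, with b the base of h, gives d_g x_h =
x_h d_h = x_h (x_h + x_b). The right-hand side does not involve g, so the difference of d_g and the
d of the base vertex on the level of g annihilates x_h. -/
theorem rel_vertexGen : (Γ.alphabet star hlevel).Rel (1 : K) (Γ.vertexGen K) := by
  have key : ∀ (g h : {v : V // v ≠ star}), (Γ.alphabet star hlevel).Forb g h →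
      Γ.downEdge K star g * Γ.vertexGen K h =
        Γ.vertexGen K h * Γ.vertexGen K h +
          Γ.vertexGen K h * Γ.vertexGen K ((Γ.alphabet star hlevel).base h) := by
    intro g h hf
    obtain ⟨e, he, he'⟩ := hcomplete g h hf.2
    obtain ⟨h1, h2⟩ := Γ.edge_relations hlevel K hcomplete hminimal e
    have hb : Γ.basePoint star (Γ.level h) ≠ h := fun hb => hf.1 (Subtype.ext hb)
    have k1 : Γ.vertexGen K h = Γ.downEdge K star h -
        Γ.downEdge K star (Γ.basePoint star (Γ.level h)) := by rw [vertexGen, if_neg hb]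
    have k2 := Γ.vertexGen_base hlevel K h
    rw [he, he', ← k1] at h1
    rw [he, he', h1, sub_mul] at h2
    rw [← mul_add, k2]
    have k3 : Γ.vertexGen K h + Γ.downEdge K star (Γ.basePoint star (Γ.level h)) =
        Γ.downEdge K star h := by rw [k1, sub_add_cancel]
    rw [k3]
    nth_rewrite 1 [k1]
    rw [mul_sub, ← h2, sub_sub_cancel]
  constructor
  · intro g h hf hg
    have hg' : Γ.basePoint star (Γ.level g) ≠ g := fun hb => hg (Subtype.ext hb)
    have e1 := key g h hf
    have e2 := key _ h ((forb_congr (level_base _ g)).2 hf)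
    rw [vertexGen, if_neg hg', sub_mul, e1, ← e2, alphabet_base, sub_self]
  · intro g h hf hg
    have hg' : Γ.basePoint star (Γ.level g) = g := congrArg Subtype.val hg
    rw [one_smul, ← key g h hf]
    congr 1
    rw [vertexGen, if_pos hg']

omit hcomplete hminimal in
theorem downEdge_mem (v : V) : Γ.downEdge K star v ∈ Submodule.span K
    {x | ∃ g : {v : V // v ≠ star}, Γ.level g = Γ.level v ∧ x = Γ.vertexGen K g} := by
  by_cases hv : v = star
  · rw [hv, Γ.downEdge_star hlevel K]
    exact zero_mem _
  · have hb : Γ.downEdge K star (Γ.basePoint star (Γ.level v)) ∈ Submodule.span K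
        {x | ∃ g : {v : V // v ≠ star}, Γ.level g = Γ.level v ∧ x = Γ.vertexGen K g} := by
      refine Submodule.subset_span
        ⟨(Γ.alphabet star hlevel).base ⟨v, hv⟩, Γ.level_basePoint star v, ?_⟩
      rw [vertexGen_base]
    by_cases h : Γ.basePoint star (Γ.level v) = v
    · rwa [h] at hb
    · have hg : Γ.vertexGen K ⟨v, hv⟩ ∈ Submodule.span K
          {x | ∃ g : {v : V // v ≠ star}, Γ.level g = Γ.level v ∧ x = Γ.vertexGen K g} :=
        Submodule.subset_span ⟨⟨v, hv⟩, rfl, rfl⟩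
      rw [vertexGen, if_neg h] at hg
      simpa using add_mem hg hb

theorem edge_mul_mem (e : E) {n l : ℕ} {a : Γ.SplittingAlgebra K}
    (ha : a ∈ (Γ.alphabet star hlevel).normalSpan K (Γ.vertexGen K) n l) :
    Γ.edge K e * a ∈ (Γ.alphabet star hlevel).normalSpan K (Γ.vertexGen K) (n + 1)
      (Γ.level (Γ.tail e) + l) := by
  have hγ := Γ.rel_vertexGen hlevel K hcomplete hminimal
  have key : ∀ v, Γ.level v ≤ Γ.level (Γ.tail e) → Γ.downEdge K star v * a ∈
      (Γ.alphabet star hlevel).normalSpan K (Γ.vertexGen K) (n + 1) (Γ.level (Γ.tail e) + l) := by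
    intro v hv
    have h := Γ.downEdge_mem hlevel K v
    generalize Γ.downEdge K star v = x at h
    induction h using Submodule.span_induction with
    | zero => simp
    | add x y _ _ hx hy => rw [add_mul]; exact add_mem hx hy
    | smul r x _ hx => rw [smul_mul_assoc]; exact Submodule.smul_mem _ _ hx
    | mem x hx =>
      obtain ⟨g, hg, rfl⟩ := hx
      refine normalSpan_mono ?_ (hγ.mul_mem_normalSpan g ha)
      rw [alphabet_level]
      omega
  have hl := Γ.level_tail e
  rw [(Γ.edge_relations hlevel K hcomplete hminimal e).1, sub_mul, sub_mul]
  refine sub_mem (key _ le_rfl) (sub_mem (key _ (by omega)) (key _ ?_))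
  rw [level_basePoint]
  omega

/-- Length and weight are bounded simultaneously, so this one statement serves both the degree
components and the level filtration. -/
theorem edges_mem (π : List E) : (π.map (Γ.edge K)).prod ∈
    (Γ.alphabet star hlevel).normalSpan K (Γ.vertexGen K) π.length
      (π.map fun e => Γ.level (Γ.tail e)).sum := by
  induction π with
  | nil => exact prod_mem_normalSpan isNormal_nil rfl le_rfl
  | cons e π ih => simpa using Γ.edge_mul_mem hlevel K hcomplete hminimal e ih

theorem span_normal_eq_top : Submodule.span K (Set.range
    fun w : {w : List {v : V // v ≠ star} // (Γ.alphabet star hlevel).IsNormal w} =>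
      (w.1.map (Γ.vertexGen K)).prod) = ⊤ := by
  set S := Submodule.span K (Set.range
    fun w : {w : List {v : V // v ≠ star} // (Γ.alphabet star hlevel).IsNormal w} =>
      (w.1.map (Γ.vertexGen K)).prod) with hS
  have hle : ∀ n l, (Γ.alphabet star hlevel).normalSpan K (Γ.vertexGen K) n l ≤ S := fun n l =>
    Submodule.span_mono fun _ ⟨w, hw, _, _, hx⟩ => ⟨⟨w, hw⟩, hx.symm⟩
  have hedge : ∀ e, ∀ a ∈ S, Γ.edge K e * a ∈ S := by
    intro e a ha
    induction ha using Submodule.span_induction with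
    | zero => simp
    | add x y _ _ hx hy => rw [mul_add]; exact add_mem hx hy
    | smul r x _ hx => rw [mul_smul_comm]; exact Submodule.smul_mem _ _ hx
    | mem x hx =>
      obtain ⟨w, rfl⟩ := hx
      exact hle _ _ (Γ.edge_mul_mem hlevel K hcomplete hminimal e
        (prod_mem_normalSpan w.2 rfl le_rfl))
  have hmul : ∀ x : FreeAlgebra K E, ∀ a ∈ S, Γ.edgeHom K x * a ∈ S := by
    intro x
    induction x using FreeAlgebra.induction with
    | grade0 r =>
      intro a ha
      rw [AlgHom.commutes, ← Algebra.smul_def]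
      exact Submodule.smul_mem _ _ ha
    | grade1 e => exact hedge e
    | mul x y hx hy =>
      intro a ha
      rw [map_mul, mul_assoc]
      exact hx _ (hy _ ha)
    | add x y hx hy =>
      intro a ha
      rw [map_add, add_mul]
      exact add_mem (hx _ ha) (hy _ ha)
  rw [eq_top_iff]
  rintro x -
  obtain ⟨x, rfl⟩ := Γ.edgeHom_surjective K x
  have := hmul x 1 (Submodule.subset_span ⟨⟨[], isNormal_nil⟩, by simp⟩)
  simpa using this

/-- The action on normal words factors through A(Γ), and d_v acts as `offBase` at v plus the base
letter of its level. Since `offBase` vanishes at base vertices, each x_v acts exactly as its letter.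
-/
theorem linearIndependent_normal : LinearIndependent K
    fun w : {w : List {v : V // v ≠ star} // (Γ.alphabet star hlevel).IsNormal w} =>
      (w.1.map (Γ.vertexGen K)).prod := by
  set L := Γ.alphabet star hlevel
  have hrel := L.rel_letterEnd K
  let ρ : Γ.SplittingAlgebra K →ₐ[K] Module.End K ({w // L.IsNormal w} →₀ K) :=
    Γ.liftSplitting (Γ.edgeImage (L.letterEnd K)) (Γ.prod_edgeImage_eq hlevel hrel)
  have hdown : ∀ v : {v : V // v ≠ star}, ρ (Γ.downEdge K star v) =
      Γ.offBase (L.letterEnd K) v + L.letterEnd K (L.base v) := by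
    intro v
    obtain ⟨u, hu⟩ := Γ.exists_level_succ hlevel hminimal (v := v) (fun h => v.2 ((hlevel _).1 h))
    obtain ⟨e, het, heh⟩ := Γ.exists_downEdge (star := star) hcomplete hu
    have h1 := Γ.downEdge_eq K (star := star) (e := e) (by rw [heh, het])
    rw [het] at h1
    rw [h1, Γ.liftSplitting_edge, Γ.edgeImage_of_head_eq heh, het, Γ.onBase_level hlevel]
  refine linearIndependent_of_algHom ρ fun g => ?_
  by_cases hg : Γ.basePoint star (Γ.level g) = g
  · have hg' : L.base g = g := Subtype.ext hg
    have := Γ.offBase_basePoint (γ := L.letterEnd K) (Γ.level g)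
    rw [hg] at this
    rw [vertexGen, if_pos hg, hdown, hg', this, zero_add]
  · have h2 := hdown (L.base g)
    rw [base_base, show Γ.offBase (L.letterEnd K) (L.base g) = 0 from Γ.offBase_basePoint _,
      zero_add] at h2
    replace h2 : ρ (Γ.downEdge K star (Γ.basePoint star (Γ.level g))) =
      L.letterEnd K (L.base g) := h2
    rw [vertexGen, if_neg hg, map_sub, hdown, h2, offBase, dif_pos ⟨g.2, hg⟩]
    exact add_sub_cancel_right (L.letterEnd K g) _

/-- The basis of the splitting algebra given by the normal words. -/
noncomputable def normalBasis : Module.Basis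
    {w : List {v : V // v ≠ star} // (Γ.alphabet star hlevel).IsNormal w} K
    (Γ.SplittingAlgebra K) :=
  Module.Basis.mk (Γ.linearIndependent_normal hlevel K hcomplete hminimal)
    (Γ.span_normal_eq_top hlevel K hcomplete hminimal).ge

theorem normalBasis_apply (w) : Γ.normalBasis hlevel K hcomplete hminimal w =
    (w.1.map (Γ.vertexGen K)).prod := by
  rw [normalBasis, Module.Basis.mk_apply]

omit hlevel hcomplete hminimal in
theorem vertexGen_mem (g : {v : V // v ≠ star}) : Γ.vertexGen K g ∈
    Submodule.span K {x | ∃ e, Γ.level (Γ.tail e) = Γ.level g ∧ x = Γ.edge K e} := by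
  have key : ∀ v : V, Γ.level v = Γ.level g → Γ.downEdge K star v ∈
      Submodule.span K {x | ∃ e, Γ.level (Γ.tail e) = Γ.level g ∧ x = Γ.edge K e} := by
    intro v hv
    rw [downEdge]
    split_ifs with h
    · exact Submodule.subset_span ⟨h.choose, by rw [h.choose_spec.1, hv], rfl⟩
    · exact zero_mem _
  rw [vertexGen]
  split_ifs
  · exact key _ rfl
  · exact sub_mem (key _ rfl) (key _ (Γ.level_basePoint star g))

theorem degreePart_eq (n : ℕ) :
    Γ.degreePart K n = (Γ.alphabet star hlevel).lengthSpan K (Γ.vertexGen K) n := by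
  refine le_antisymm (Submodule.span_le.2 ?_) (Submodule.span_le.2 ?_)
  · rintro _ ⟨π, rfl, rfl⟩
    exact normalSpan_le_lengthSpan _ _ (Γ.edges_mem hlevel K hcomplete hminimal π)
  · rintro _ ⟨w, -, rfl, rfl⟩
    induction w with
    | nil => exact Submodule.subset_span ⟨[], rfl, by simp⟩
    | cons g w ih =>
      have h := Submodule.mul_mem_mul (Γ.vertexGen_mem K g) ih
      rw [degreePart, Submodule.span_mul_span] at h
      rw [List.map_cons, List.prod_cons]
      refine Submodule.span_mono ?_ h
      rintro _ ⟨_, ⟨e, _, rfl⟩, _, ⟨π, hπ, rfl⟩, rfl⟩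
      exact ⟨e :: π, by simp [hπ], by simp⟩

theorem levelPart_eq (l : ℕ) :
    Γ.levelPart K l = Submodule.span K (Γ.normalBasis hlevel K hcomplete hminimal ''
      {w | (Γ.alphabet star hlevel).weight w.1 ≤ l}) := by
  refine le_antisymm (Submodule.span_le.2 ?_) (Submodule.span_le.2 ?_)
  · rintro _ ⟨π, hl, rfl⟩
    refine (Submodule.span_mono ?_ : _ ≤ _) (normalSpan_mono hl
      (Γ.edges_mem hlevel K hcomplete hminimal π))
    rintro _ ⟨w, hw, _, hl, rfl⟩
    exact ⟨⟨w, hw⟩, hl, Γ.normalBasis_apply hlevel K hcomplete hminimal _⟩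
  · have key : ∀ w : List {v : V // v ≠ star}, (w.map (Γ.vertexGen K)).prod ∈
        Γ.levelPart K ((Γ.alphabet star hlevel).weight w) := by
      intro w
      induction w with
      | nil => exact (Γ.filtration K).one_mem
      | cons g w ih =>
        rw [List.map_cons, List.prod_cons, weight_cons]
        refine (Γ.filtration K).mul_mem (Submodule.span_mono ?_
          (Γ.vertexGen_mem K g)) ih
        rintro _ ⟨e, he, rfl⟩
        exact ⟨[e], by simp [he, alphabet_level], by simp⟩
    rintro _ ⟨w, hl, rfl⟩
    rw [normalBasis_apply]
    exact (Γ.filtration K).mono hl (key w.1)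

end LayeredGraph

/-! ### Transfer of the normal basis to the associated graded algebra. -/

namespace AlgFiltration

variable {K : Type uK} {A : Type uA} [Field K] [Ring A] [Algebra K A] (F : AlgFiltration K A)

theorem symbol_mul_symbol {i j : ℕ} (a : F.part i) (b : F.part j) :
    F.symbol i a * F.symbol j b = F.symbol (i + j) ⟨(a : A) * b, F.mul_mem a.2 b.2⟩ :=
  DirectSum.of_mul_of _ _

theorem symbol_one : F.symbol 0 ⟨1, F.one_mem⟩ = 1 := rfl

theorem symbol_congr {i j : ℕ} (h : i = j) {a : F.part i} {b : F.part j} (hab : (a : A) = b) :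
    F.symbol i a = F.symbol j b := by
  subst h
  rw [Subtype.ext hab]

theorem part_le_below {i j : ℕ} (h : j < i) : F.part j ≤ F.below i :=
  le_iSup₂_of_le j h le_rfl

theorem symbol_eq_zero {i : ℕ} {a : F.part i} (h : (a : A) ∈ F.below i) : F.symbol i a = 0 := by
  rw [symbol, LinearMap.comp_apply, F.cls_eq_zero.2 h, map_zero]

end AlgFiltration

namespace LevelAlphabet

open Module

variable {G : Type*} {L : LevelAlphabet G} {K : Type uK} {A : Type uA} [Field K] [Ring A]
  [Algebra K A] {F : AlgFiltration K A} {ε : K} {γ : G → A}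
  {b : Basis {w : List G // L.IsNormal w} K A}

variable (F) in
/-- The symbols of the letters in the associated graded algebra. -/
def letterSymbol (hmem : ∀ g, γ g ∈ F.part (L.level g)) (g : G) : F.Gr :=
  F.symbol (L.level g) ⟨γ g, hmem g⟩

variable (hmem : ∀ g, γ g ∈ F.part (L.level g))

include hmem in
theorem prod_mem_part (w : List G) : (w.map γ).prod ∈ F.part (L.weight w) := by
  induction w with
  | nil => exact F.one_mem
  | cons g w ih => simpa using F.mul_mem (hmem g) ih

theorem prod_letterSymbol (w : List G) : (w.map (letterSymbol F hmem)).prod =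
    F.symbol (L.weight w) ⟨(w.map γ).prod, prod_mem_part hmem w⟩ := by
  induction w with
  | nil => exact F.symbol_one.symm
  | cons g w ih =>
    rw [List.map_cons, List.prod_cons, ih, letterSymbol, F.symbol_mul_symbol]
    exact F.symbol_congr (by simp) (by simp)

/-- The right-hand side of each rule has weight one less than the left, so its symbol vanishes and
only the monomial rules survive. -/
theorem Rel.letterSymbol (hγ : L.Rel ε γ) : L.Rel (0 : K) (letterSymbol F hmem) := by
  have key : ∀ g h, L.Forb g h →
      LevelAlphabet.letterSymbol F hmem g * LevelAlphabet.letterSymbol F hmem h = 0 := by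
    intro g h hf
    rw [LevelAlphabet.letterSymbol, LevelAlphabet.letterSymbol, F.symbol_mul_symbol]
    refine F.symbol_eq_zero ?_
    change γ g * γ h ∈ _
    by_cases hg : L.base g = g
    · have hlt : L.level h + L.level h < L.level g + L.level h := by
        have := hf.2
        omega
      rw [hγ.mul_eq hf hg]
      refine F.part_le_below hlt (Submodule.smul_mem _ _ (add_mem (F.mul_mem (hmem h) (hmem h)) ?_))
      have hbase := hmem (L.base h)
      rw [L.level_base] at hbase
      exact F.mul_mem (hmem h) hbase
    · rw [hγ.mul_eq_zero hf hg]
      exact zero_mem _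
  exact ⟨fun hf _ => key _ _ hf, fun hf _ => by rw [key _ _ hf, zero_smul]⟩

variable (hb : ∀ w, b w = (w.1.map γ).prod)

include hb in
theorem symbol_mem_span {i : ℕ} {s : Set {w : List G // L.IsNormal w}}
    (hs : ∀ w ∈ s, L.weight w.1 ≤ i) {a : F.part i} (ha : (a : A) ∈ Submodule.span K (b '' s)) :
    F.symbol i a ∈
      Submodule.span K ((fun w => (w.1.map (letterSymbol F hmem)).prod) '' s) := by
  have hle : Submodule.span K (b '' s) ≤ F.part i := by
    rw [Submodule.span_le]
    rintro _ ⟨w, hw, rfl⟩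
    rw [hb]
    exact F.mono (hs w hw) (prod_mem_part hmem w.1)
  suffices h : ∀ x (hx : x ∈ Submodule.span K (b '' s)), F.symbol i ⟨x, hle hx⟩ ∈
      Submodule.span K ((fun w => (w.1.map (letterSymbol F hmem)).prod) '' s) from h a ha
  intro x hx
  induction hx using Submodule.span_induction with
  | zero =>
    rw [F.symbol_eq_zero (zero_mem _)]
    exact zero_mem _
  | add x y hx hy h1 h2 =>
    have h := add_mem h1 h2
    rw [← map_add] at h
    exact h
  | smul r x hx h1 =>
    have h := Submodule.smul_mem _ r h1
    rw [← map_smul] at h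
    exact h
  | mem x hx =>
    obtain ⟨w, hw, rfl⟩ := hx
    rcases (hs w hw).lt_or_eq with hlt | heq
    · rw [F.symbol_eq_zero]
      · exact zero_mem _
      · refine F.part_le_below hlt ?_
        change b w ∈ _
        rw [hb]
        exact prod_mem_part hmem w.1
    · refine Submodule.subset_span ⟨w, hw, ?_⟩
      dsimp only
      rw [prod_letterSymbol]
      exact F.symbol_congr heq (hb w).symm

variable (hF : ∀ l, F.part l = Submodule.span K (b '' {w | L.weight w.1 ≤ l}))

include hb hF in
theorem span_letterSymbol_eq_top : Submodule.span K (Set.range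
    fun w : {w : List G // L.IsNormal w} => (w.1.map (letterSymbol F hmem)).prod) = ⊤ := by
  rw [eq_top_iff]
  rintro x -
  induction x using DirectSum.induction_on with
  | zero => exact zero_mem _
  | add x y hx hy => exact add_mem hx hy
  | of i p =>
    obtain ⟨a, rfl⟩ := F.cls_surjective i p
    have ha : (a : A) ∈ Submodule.span K (b '' {w | L.weight w.1 ≤ i}) := hF i ▸ a.2
    exact Submodule.span_mono (Set.image_subset_range _ _)
      (symbol_mem_span hmem hb (fun w hw => hw) ha)

open Classical in
/-- The part of weight `i` of the coordinates of an element. -/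
noncomputable def weightRepr (b : Basis {w : List G // L.IsNormal w} K A) (i : ℕ) :
    A →ₗ[K] ({w : List G // L.IsNormal w} →₀ K) :=
  (Finsupp.linearCombination K fun w : {w : List G // L.IsNormal w} =>
    if L.weight w.1 = i then Finsupp.single w 1 else 0).comp b.repr.toLinearMap

theorem weightRepr_apply (i : ℕ) (w : {w : List G // L.IsNormal w}) [Decidable (L.weight w.1 = i)] :
    weightRepr b i (b w) = if L.weight w.1 = i then Finsupp.single w 1 else 0 := by
  simp [weightRepr]

-- Elements strictly below i involve only words of weight less than i. Hence the weight-i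
-- coordinates descend to the quotient and detect independence of the symbols.
include hF in
theorem weightRepr_eq_zero {i : ℕ} {a : A} (ha : a ∈ F.below i) : weightRepr b i a = 0 := by
  have hle : F.below i ≤ LinearMap.ker (weightRepr b i) := by
    refine iSup₂_le fun j hj => ?_
    rw [hF, Submodule.span_le]
    rintro _ ⟨w, hw, rfl⟩
    classical
    rw [SetLike.mem_coe, LinearMap.mem_ker, weightRepr_apply, if_neg]
    exact (lt_of_le_of_lt hw hj).ne
  exact hle ha

/-- The coordinates on the associated graded algebra. -/
noncomputable def grRepr : F.Gr →ₗ[K] ({w : List G // L.IsNormal w} →₀ K) :=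
  DirectSum.toModule K ℕ _ fun i => Submodule.liftQ _ ((weightRepr b i).comp (F.part i).subtype)
    fun _ ha => weightRepr_eq_zero hF ha

theorem grRepr_symbol {i : ℕ} (a : F.part i) : grRepr hF (F.symbol i a) = weightRepr b i a := by
  rw [grRepr, AlgFiltration.symbol, LinearMap.comp_apply, DirectSum.toModule_lof]
  rfl

include hb hF in
theorem linearIndependent_letterSymbol : LinearIndependent K
    fun w : {w : List G // L.IsNormal w} => (w.1.map (letterSymbol F hmem)).prod := by
  refine LinearIndependent.of_comp (grRepr hF) ?_
  convert Finsupp.linearIndependent_single_one K {w : List G // L.IsNormal w} using 1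
  funext w
  classical
  rw [Function.comp_apply, prod_letterSymbol, grRepr_symbol]
  change weightRepr b _ (w.1.map γ).prod = _
  rw [← hb, weightRepr_apply, if_pos rfl]

/-- The basis of the associated graded algebra given by the normal words. -/
noncomputable def grBasis : Basis {w : List G // L.IsNormal w} K F.Gr :=
  Basis.mk (linearIndependent_letterSymbol hmem hb hF) (span_letterSymbol_eq_top hmem hb hF).ge

theorem grBasis_apply (w) :
    grBasis hmem hb hF w = (w.1.map (letterSymbol F hmem)).prod := by
  rw [grBasis, Basis.mk_apply]

include hb hF in
theorem inducedPart_lengthSpan (n : ℕ) : F.inducedPart (L.lengthSpan K γ n) =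
    L.lengthSpan K (letterSymbol F hmem) n := by
  refine le_antisymm (iSup_le fun i => ?_) (Submodule.span_le.2 ?_)
  · rintro _ ⟨a, ha, rfl⟩
    have ha' : (a : A) ∈ Submodule.span K (b '' {w | L.weight w.1 ≤ i}) := hF i ▸ a.2
    change (a : A) ∈ L.lengthSpan K γ n at ha
    rw [lengthSpan_eq hb, Basis.mem_span_image] at ha
    rw [Basis.mem_span_image] at ha'
    -- Both subspaces are spanned by parts of the same basis, so an element of the intersection
    -- involves only words that satisfy both the length and the weight condition.
    have h := symbol_mem_span hmem hb (a := a) (i := i)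
      (s := {w | w.1.length = n} ∩ {w | L.weight w.1 ≤ i}) (fun w hw => hw.2)
      ((Basis.mem_span_image b).2 (Set.subset_inter ha ha'))
    refine Submodule.span_mono ?_ h
    rintro _ ⟨w, hw, rfl⟩
    exact ⟨w.1, w.2, hw.1, rfl⟩
  · rintro _ ⟨w, hw, hn, rfl⟩
    rw [prod_letterSymbol]
    exact Submodule.mem_iSup_of_mem (L.weight w)
      (Submodule.mem_map_of_mem (Submodule.subset_span ⟨w, hw, hn, rfl⟩))

end LevelAlphabet

theorem theorem6p2 {K : Type uK} [Field K] {V : Type uV} {E : Type uE} (Γ : LayeredGraph V E)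
    (hcomplete : Γ.IsComplete) (star : V)
    (hlevel : ∀ v, Γ.level v = 0 ↔ v = star)
    (hminimal : ∀ v, Γ.IsMinimal v ↔ v = star) :
    IsKoszul K (Γ.GrSplittingAlgebra K) (Γ.grDegreePart K) ∧
      IsKoszul K (Γ.SplittingAlgebra K) (Γ.degreePart K) := by
  have hγ := Γ.rel_vertexGen hlevel K hcomplete hminimal
  have hb := Γ.normalBasis_apply hlevel K hcomplete hminimal
  have hdeg : Γ.degreePart K = (Γ.alphabet star hlevel).lengthSpan K (Γ.vertexGen K) :=
    funext (Γ.degreePart_eq hlevel K hcomplete hminimal)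
  have hF : ∀ l, (Γ.filtration K).part l = _ := Γ.levelPart_eq hlevel K hcomplete hminimal
  have hmem : ∀ g, Γ.vertexGen K g ∈
      (Γ.filtration K).part ((Γ.alphabet star hlevel).level g) := by
    intro g
    rw [hF]
    refine Submodule.subset_span ⟨⟨[g], LevelAlphabet.isNormal_singleton g⟩, by simp, ?_⟩
    simp [hb]
  have hgr : Γ.grDegreePart K = (Γ.alphabet star hlevel).lengthSpan K
      (LevelAlphabet.letterSymbol (Γ.filtration K) hmem) := by
    funext n
    rw [LayeredGraph.grDegreePart, hdeg, LevelAlphabet.inducedPart_lengthSpan hmem hb hF]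
  rw [hgr, hdeg]
  exact ⟨(hγ.letterSymbol hmem).isKoszul (LevelAlphabet.grBasis_apply hmem hb hF),
    hγ.isKoszul hb⟩
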